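/- Let $I=[0,1]$, and let $\mathrm{Diff}_+^1(I)$ be the group of orientation preserving homeomorphisms $f$ of $I$ such that $f$ and $f^{-1}$ are $C^1$ (with one-sided derivatives at the endpoints). Let $F$ be Thompson's group, i.e. the group of piecewise linear homeomorphisms of $I$ with dyadic rational breakpoints and with slopes powers of two; its standard action on $I$ is the tautological one. For an action $\psi$ of a group $G$ on $I$ and a subset $H\subseteq G$, let $\operatorname{supp}\psi(H)$ be the set of points of $I$ moved by $\psi(g)$ for some $g\in H$. Let $F_-$ and $F_+$ be the subgroups of $F$ of elements supported in $[0,1/2]$ and in $[1/2,1]$, respectively. Let $\phi\colon F*\mathbb{Z}\to \mathrm{Diff}_+^1(I)$ be a homomorphism. Suppose that for every injective homomorphism $\iota\colon F\to F$ and every connected component $J$ of $\operatorname{supp}\phi(\iota(F))$, the action $g\mapsto\phi(\iota(g))|_J$ of $F$ on $J$ is either not faithful or semi-conjugate to the standard action of $F$; the latter means that there is a continuous, surjective, weakly monotone (order preserving or order reversing) map $h\colon\overline{J}\to I$ such that $h(\phi(\iota(g))(x))=g(h(x))$ for all $g\in F$ and $x\in\overline{J}$. Then $\phi$ is not injective.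 Moreover, $\operatorname{supp}\phi([F_-,F_-])\cap\operatorname{supp}\phi([F_+,F_+])=\varnothing$. -/

import Mathlib

namespace ThompsonFree

/-- `Homeo₊(I)` for `I = [0,1]`: orientation preserving homeomorphisms of `I` are exactly the
order automorphisms of `I`. The group law is composition. -/
abbrev HomeoPlus : Type := unitInterval ≃o unitInterval

theorem mul_apply (f g : HomeoPlus) (x : unitInterval) : (f * g) x = f (g x) := rfl

theorem one_apply (x : unitInterval) : (1 : HomeoPlus) x = x := rfl

theorem inv_apply_apply (f : HomeoPlus) (x : unitInterval) : f⁻¹ (f x) = x :=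
  f.symm_apply_apply x

theorem apply_inv_apply (f : HomeoPlus) (x : unitInterval) : f (f⁻¹ x) = x :=
  f.apply_symm_apply x

/-! ### The group of `C¹` diffeomorphisms of the interval -/

/-- A homeomorphism of `I`, viewed as a real function (constant on each side of `[0,1]`;
only its values on `[0,1]` are ever used). -/
noncomputable def toReal (f : HomeoPlus) : ℝ → ℝ :=
  Set.IccExtend (zero_le_one' ℝ) (fun x : unitInterval => (f x : ℝ))

theorem toReal_coe (f : HomeoPlus) (x : unitInterval) : toReal f x = f x :=
  Set.IccExtend_val _ _ x

/-- `f` is continuously differentiable on `[0,1]` (one-sided derivatives at the endpoints). -/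
def IsC1 (f : HomeoPlus) : Prop := ContDiffOn ℝ 1 (toReal f) (Set.Icc 0 1)

theorem IsC1.one : IsC1 1 := by
  refine (contDiffOn_id (𝕜 := ℝ) (E := ℝ) (n := 1)).congr ?_
  intro x hx
  exact toReal_coe 1 ⟨x, hx⟩

theorem IsC1.mul {f g : HomeoPlus} (hf : IsC1 f) (hg : IsC1 g) : IsC1 (f * g) := by
  have h : ContDiffOn ℝ 1 (toReal f ∘ toReal g) (Set.Icc 0 1) := by
    refine ContDiffOn.comp hf hg ?_
    intro x hx
    have h1 := toReal_coe g ⟨x, hx⟩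
    simp only at h1
    rw [h1]
    exact (g ⟨x, hx⟩).2
  refine h.congr ?_
  intro x hx
  have h1 := toReal_coe g ⟨x, hx⟩
  have h2 := toReal_coe (f * g) ⟨x, hx⟩
  simp only at h1 h2
  rw [Function.comp_apply, h1, h2, toReal_coe]
  rfl

/-- `Diff₊¹(I)`: the orientation preserving homeomorphisms `f` of `I = [0,1]` such that `f` and
`f⁻¹` are `C¹`. -/
def diffPlus : Subgroup HomeoPlus where
  carrier := {f | IsC1 f ∧ IsC1 f⁻¹}
  one_mem' := ⟨IsC1.one, by rw [inv_one]; exact IsC1.one⟩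
  mul_mem' := by
    rintro f g ⟨hf, hf'⟩ ⟨hg, hg'⟩
    exact ⟨hf.mul hg, by rw [mul_inv_rev]; exact hg'.mul hf'⟩
  inv_mem' := by
    rintro f ⟨hf, hf'⟩
    exact ⟨hf', by rw [inv_inv]; exact hf⟩

/-! ### Thompson's group `F` -/

def IsDyadic (x : ℝ) : Prop := ∃ (m : ℤ) (n : ℕ), x = m / 2 ^ n

/-- `f` is affine on `[a,b]`, and its slope is a power of two. -/
def IsAffineOn (f : HomeoPlus) (a b : unitInterval) : Prop :=
  ∃ (k : ℤ) (c : ℝ), ∀ x ∈ Set.Icc a b, (f x : ℝ) = (2 : ℝ) ^ k * (x : ℝ) + c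

/-- `f` is piecewise linear with all breakpoints in `s`, and its slopes are powers of two. -/
def IsPL (f : HomeoPlus) (s : Finset unitInterval) : Prop :=
  ∀ a b : unitInterval, (∀ x ∈ s, x ∉ Set.Ioo a b) → IsAffineOn f a b

/-- `f` is piecewise linear with dyadic breakpoints, and its slopes are powers of two. -/
def IsThompson (f : HomeoPlus) : Prop :=
  ∃ s : Finset unitInterval, (∀ x ∈ s, IsDyadic x) ∧ IsPL f s

theorem IsDyadic.zero : IsDyadic 0 := ⟨0, 0, by simp⟩

theorem IsDyadic.add {x y : ℝ} (hx : IsDyadic x) (hy : IsDyadic y) : IsDyadic (x + y) := by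
  obtain ⟨m, n, rfl⟩ := hx
  obtain ⟨m', n', rfl⟩ := hy
  refine ⟨m * 2 ^ n' + m' * 2 ^ n, n + n', ?_⟩
  push_cast
  rw [pow_add]
  field_simp

theorem IsDyadic.neg {x : ℝ} (hx : IsDyadic x) : IsDyadic (-x) := by
  obtain ⟨m, n, rfl⟩ := hx
  exact ⟨-m, n, by push_cast; ring⟩

theorem IsDyadic.zpow_mul {x : ℝ} (hx : IsDyadic x) (k : ℤ) : IsDyadic ((2 : ℝ) ^ k * x) := by
  obtain ⟨m, n, rfl⟩ := hx
  obtain ⟨l, rfl | rfl⟩ := k.eq_nat_or_neg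
  · exact ⟨2 ^ l * m, n, by push_cast; rw [zpow_natCast]; ring⟩
  · refine ⟨m, l + n, ?_⟩
    rw [zpow_neg, zpow_natCast, pow_add]
    field_simp

theorem IsThompson.isDyadic_apply {f : HomeoPlus} (hf : IsThompson f) {t : unitInterval}
    (ht : IsDyadic t) : IsDyadic (f t) := by
  obtain ⟨s, hs, hpl⟩ := hf
  have key : ∀ (n : ℕ) (t : unitInterval), (s.filter (· < t)).card = n → IsDyadic t →
      IsDyadic (f t) := by
    intro n
    induction n using Nat.strong_induction_on with
    | _ n ih =>
      intro t hn ht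
      have step : ∀ m : unitInterval, m ≤ t → IsDyadic m → IsDyadic (f m) →
          (∀ x ∈ s, x ∉ Set.Ioo m t) → IsDyadic (f t) := by
        intro m hmt hm hfm hfree
        obtain ⟨k, c, hkc⟩ := hpl m t hfree
        have h1 := hkc m ⟨le_rfl, hmt⟩
        have h2 := hkc t ⟨hmt, le_rfl⟩
        have h3 : (f t : ℝ) = f m + (2 : ℝ) ^ k * ((t : ℝ) + -(m : ℝ)) := by
          rw [h1, h2]; ring
        rw [h3]
        exact hfm.add ((ht.add hm.neg).zpow_mul k)
      rcases (s.filter (· < t)).eq_empty_or_nonempty with h0 | h0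
      · refine step 0 t.2.1 IsDyadic.zero ?_ ?_
        · have : f 0 = 0 := f.map_bot
          rw [this]
          exact IsDyadic.zero
        · intro x hx hx'
          have : x ∈ s.filter (· < t) := Finset.mem_filter.2 ⟨hx, hx'.2⟩
          rw [h0] at this
          simp at this
      · have hm := Finset.max'_mem _ h0
        set m := (s.filter (· < t)).max' h0 with hmdef
        obtain ⟨hms, hmt⟩ := Finset.mem_filter.1 hm
        refine step m hmt.le (hs m hms) ?_ ?_
        · refine ih _ ?_ m rfl (hs m hms)
          rw [← hn]
          refine Finset.card_lt_card (Finset.ssubset_iff_of_subset ?_ |>.2 ⟨m, hm, by simp⟩)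
          intro x hx
          rw [Finset.mem_filter] at hx ⊢
          exact ⟨hx.1, hx.2.trans hmt⟩
        · intro x hx hx'
          exact absurd (Finset.le_max' _ x (Finset.mem_filter.2 ⟨hx, hx'.2⟩)) (not_le.2 hx'.1)
  exact key _ t rfl ht

theorem IsThompson.one : IsThompson 1 :=
  ⟨∅, by simp, fun _ _ _ => ⟨0, 0, fun x _ => by simp [one_apply]⟩⟩

theorem IsThompson.inv {f : HomeoPlus} (hf : IsThompson f) : IsThompson f⁻¹ := by
  have hf' := hf
  obtain ⟨s, hs, hpl⟩ := hf
  refine ⟨s.image f, ?_, ?_⟩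
  · intro x hx
    obtain ⟨y, hy, rfl⟩ := Finset.mem_image.1 hx
    exact hf'.isDyadic_apply (hs y hy)
  · intro a b hab
    obtain ⟨k, c, hkc⟩ := hpl (f⁻¹ a) (f⁻¹ b) (by
      intro x hx hx'
      refine hab (f x) (Finset.mem_image_of_mem f hx) ⟨?_, ?_⟩
      · have := f.strictMono hx'.1
        rwa [apply_inv_apply] at this
      · have := f.strictMono hx'.2
        rwa [apply_inv_apply] at this)
    refine ⟨-k, -((2 : ℝ) ^ (-k) * c), ?_⟩
    intro x hx
    have h := hkc (f⁻¹ x) ⟨(f⁻¹).monotone hx.1, (f⁻¹).monotone hx.2⟩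
    rw [apply_inv_apply] at h
    have h2 : (2 : ℝ) ^ k ≠ 0 := by positivity
    rw [h, zpow_neg]
    field_simp
    ring

theorem IsThompson.mul {f g : HomeoPlus} (hf : IsThompson f) (hg : IsThompson g) :
    IsThompson (f * g) := by
  have hg' := hg.inv
  obtain ⟨s, hs, hpl⟩ := hf
  obtain ⟨s', hs', hpl'⟩ := hg
  refine ⟨s' ∪ s.image (g⁻¹ : HomeoPlus), ?_, ?_⟩
  · intro x hx
    rcases Finset.mem_union.1 hx with hx | hx
    · exact hs' x hx
    · obtain ⟨y, hy, rfl⟩ := Finset.mem_image.1 hx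
      exact hg'.isDyadic_apply (hs y hy)
  · intro a b hab
    obtain ⟨k', c', h'⟩ := hpl' a b fun x hx => hab x (Finset.mem_union_left _ hx)
    obtain ⟨k, c, h⟩ := hpl (g a) (g b) (by
      intro x hx hx'
      refine hab (g⁻¹ x)
        (Finset.mem_union_right _ (Finset.mem_image_of_mem (g⁻¹ : HomeoPlus) hx)) ⟨?_, ?_⟩
      · have := (g⁻¹).strictMono hx'.1
        rwa [inv_apply_apply] at this
      · have := (g⁻¹).strictMono hx'.2
        rwa [inv_apply_apply] at this)
    refine ⟨k + k', (2 : ℝ) ^ k * c' + c, ?_⟩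
    intro x hx
    rw [mul_apply, h (g x) ⟨g.monotone hx.1, g.monotone hx.2⟩, h' x hx,
      zpow_add₀ (two_ne_zero)]
    ring

/-- Thompson's group `F`: the piecewise linear homeomorphisms of `[0,1]` whose breakpoints are
dyadic rationals and whose slopes are powers of two. -/
def thompson : Subgroup HomeoPlus where
  carrier := {f | IsThompson f}
  one_mem' := IsThompson.one
  mul_mem' := fun hf hg => hf.mul hg
  inv_mem' := fun hf => hf.inv

/-- Thompson's group `F` as a group; its standard piecewise linear action on `I` is the
inclusion into `Homeo₊(I)`. -/
abbrev F : Type := thompson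

/-- The elements of `F` supported in a subset `K` of `I`. -/
def supportedIn (K : Set unitInterval) : Subgroup F where
  carrier := {g | ∀ x : unitInterval, (g : HomeoPlus) x ≠ x → x ∈ K}
  one_mem' := fun _ hx => absurd rfl hx
  mul_mem' := by
    intro f g hf hg x hx
    by_contra hK
    have h1 : (g : HomeoPlus) x = x := by_contra fun h => hK (hg x h)
    have h2 : (f : HomeoPlus) x = x := by_contra fun h => hK (hf x h)
    refine hx ?_
    rw [Subgroup.coe_mul, mul_apply, h1, h2]
  inv_mem' := by
    intro f hf x hx
    refine hf x fun h => hx ?_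
    rw [Subgroup.coe_inv]
    conv_lhs => rw [← h]
    exact inv_apply_apply _ _

/-- `F₋`: the elements of `F` supported in `[0,1/2]`. -/
def FMinus : Subgroup F := supportedIn {x | (x : ℝ) ≤ 1 / 2}

/-- `F₊`: the elements of `F` supported in `[1/2,1]`. -/
def FPlus : Subgroup F := supportedIn {x | 1 / 2 ≤ (x : ℝ)}

/-! ### Actions by `C¹` diffeomorphisms -/

section Actions

variable {G : Type*} [Group G]

/-- `supp ψ(H)`: the points of `I` moved by some element of the subgroup `H` of `G`. -/
def supp (ψ : G →* diffPlus) (H : Subgroup G) : Set unitInterval :=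
  {x | ∃ g ∈ H, (ψ g : HomeoPlus) x ≠ x}

/-- `J` is a connected component of the subset `S` of `I`. -/
def IsComponent (J S : Set unitInterval) : Prop := ∃ x ∈ S, J = connectedComponentIn S x

/-- The action `ψ` restricted to the invariant set `J` is faithful. -/
def FaithfulOn (ψ : G →* diffPlus) (J : Set unitInterval) : Prop :=
  ∀ g : G, (∀ x ∈ J, (ψ g : HomeoPlus) x = x) → g = 1

end Actions

/-- The action `ψ` of `F` restricted to the invariant interval `J` is semi-conjugate to the
standard action of `F`: there is a continuous, (weakly) monotone map `h` from the closed interval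
`closure J` onto `I = [0,1]` which intertwines the two actions. A monotone map may preserve or
reverse the order. Values of `h` off `closure J` are irrelevant. -/
def SemiconjStandardOn (ψ : F →* diffPlus) (J : Set unitInterval) : Prop :=
  ∃ h : unitInterval → unitInterval,
    ContinuousOn h (closure J) ∧
    (MonotoneOn h (closure J) ∨ AntitoneOn h (closure J)) ∧
    h '' closure J = Set.univ ∧
    ∀ g : F, ∀ x ∈ closure J, h ((ψ g : HomeoPlus) x) = (g : HomeoPlus) (h x)

/-- The free product `F * ℤ`. -/
abbrev FStarZ : Type := Monoid.Coprod F (Multiplicative ℤ)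

/-- The restriction of an action of `F * ℤ` to the factor `F`. -/
def restrictF (φ : FStarZ →* diffPlus) : F →* diffPlus := φ.comp Monoid.Coprod.inl

end ThompsonFree

namespace ThompsonFree
open Filter Topology
open scoped commutatorElement

/-! ### Dynamics of order automorphisms of the interval -/

/-! The group `F` contains commuting copies of itself, `FMinus` and `FPlus`, and the hypothesis
applies to both embeddings `toLeft` and `toRight`. Every proper quotient of `F` is abelian
(`commutator_le_of_normal`), so on a component `(u, v)` of the support where the commutator subgroup
acts nontrivially the action is faithful, hence semi-conjugate to the standard one.

A homeomorphism `k` commuting with such an action fixes `u`, `v` and an interior point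
(`exists_fixed_of_commute`). It cannot push `(u, v)` off itself: the iterates would accumulate at a
point where all elements of the action are tangent to the identity, while the standard action
carries some interval to two disjoint subintervals of itself (`IsC1.false_of_crossing`). If supports
of the two commutator subgroups met, the two components at a common point would be comparable, and
one copy of `F` would have a global fixed point inside its own component. This gives the
disjointness.

For non-injectivity, take independent `a`, `b` in the two commutator subgroups and let `t` generate
`ℤ`. Their images have disjoint supports. Near a common fixed point, two `C¹` diffeomorphisms cannot
jump in opposite directions onto each other's fixed points, and this forces `commWord a b t` to act
trivially near every global fixed point of the whole group (`eventually_commWord_fixed`). The word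
is nontrivial (`commWord_ne_one`) and lies in the kernel of `F * ℤ → F`, a free normal subgroup. In
a faithful action no nontrivial element of such a subgroup is trivial near all global fixed points
(`eq_one_of_eventually_fixed`): it could be displaced from itself by conjugation, giving commuting
elements with different supports, whereas commuting nontrivial elements of a free group share a
power. -/

theorem apply_zero (f : HomeoPlus) : f 0 = 0 := f.map_bot

theorem apply_one (f : HomeoPlus) : f 1 = 1 := f.map_top

theorem continuous_coe (f : HomeoPlus) : Continuous f := OrderIso.continuous f

theorem lt_iff_lt (f : HomeoPlus) {x y : unitInterval} : f x < f y ↔ x < y := f.lt_iff_lt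

theorem le_iff_le (f : HomeoPlus) {x y : unitInterval} : f x ≤ f y ↔ x ≤ y := f.le_iff_le

theorem lt_inv_iff (f : HomeoPlus) {x y : unitInterval} : x < f⁻¹ y ↔ f x < y := by
  rw [← lt_iff_lt f, apply_inv_apply]

theorem inv_lt_iff (f : HomeoPlus) {x y : unitInterval} : f⁻¹ x < y ↔ x < f y := by
  rw [← lt_iff_lt f, apply_inv_apply]

theorem le_inv_iff (f : HomeoPlus) {x y : unitInterval} : x ≤ f⁻¹ y ↔ f x ≤ y := by
  rw [← le_iff_le f, apply_inv_apply]

theorem inv_le_iff (f : HomeoPlus) {x y : unitInterval} : f⁻¹ x ≤ y ↔ x ≤ f y := by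
  rw [← le_iff_le f, apply_inv_apply]

theorem inv_apply_eq_iff (f : HomeoPlus) {x y : unitInterval} : f⁻¹ x = y ↔ x = f y := by
  rw [← f.injective.eq_iff, apply_inv_apply]

theorem inv_apply_eq_self_iff (f : HomeoPlus) {x : unitInterval} : f⁻¹ x = x ↔ f x = x := by
  rw [inv_apply_eq_iff, eq_comm]

theorem pow_apply_eq_self (f : HomeoPlus) {x : unitInterval} (h : f x = x) (n : ℕ) :
    (f ^ n) x = x := by
  induction n with
  | zero => rfl
  | succ n ih => rw [pow_succ, mul_apply, h, ih]

theorem zpow_apply_eq_self (f : HomeoPlus) {x : unitInterval} (h : f x = x) (n : ℤ) :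
    (f ^ n) x = x := by
  obtain ⟨n, rfl | rfl⟩ := n.eq_nat_or_neg
  · rw [zpow_natCast, pow_apply_eq_self f h]
  · rw [zpow_neg, zpow_natCast, inv_apply_eq_self_iff, pow_apply_eq_self f h]

theorem lt_pow_apply (f : HomeoPlus) {x : unitInterval} (h : x < f x) {n : ℕ} (hn : n ≠ 0) :
    x < (f ^ n) x := by
  induction n with
  | zero => exact absurd rfl hn
  | succ n ih =>
    rcases eq_or_ne n 0 with rfl | h0
    · simpa using h
    · rw [pow_succ', mul_apply]
      exact h.trans ((lt_iff_lt f).2 (ih h0))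

/-- A point moved by an order automorphism moves monotonically along its orbit and never returns. -/
theorem pow_apply_eq_self_iff (f : HomeoPlus) {x : unitInterval} {n : ℕ} (hn : n ≠ 0) :
    (f ^ n) x = x ↔ f x = x := by
  refine ⟨fun h => ?_, fun h => pow_apply_eq_self f h n⟩
  rcases lt_trichotomy (f x) x with h1 | h1 | h1
  · have h2 : x < f⁻¹ x := (lt_inv_iff f).2 h1
    have h3 := lt_pow_apply f⁻¹ h2 hn
    rw [inv_pow, lt_inv_iff, h] at h3
    exact absurd h3 (lt_irrefl _)
  · exact h1
  · have h3 := lt_pow_apply f h1 hn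
    rw [h] at h3
    exact absurd h3 (lt_irrefl _)

theorem zpow_apply_eq_self_iff (f : HomeoPlus) {x : unitInterval} {n : ℤ} (hn : n ≠ 0) :
    (f ^ n) x = x ↔ f x = x := by
  obtain ⟨n, rfl | rfl⟩ := n.eq_nat_or_neg
  · rw [zpow_natCast, pow_apply_eq_self_iff f (by simpa using hn)]
  · rw [zpow_neg, zpow_natCast, inv_apply_eq_self_iff, pow_apply_eq_self_iff f (by simpa using hn)]

theorem monotone_pow_apply (f : HomeoPlus) {x : unitInterval} (h : x ≤ f x) :
    Monotone fun n : ℕ => (f ^ n) x :=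
  monotone_nat_of_le_succ fun n => by
    simp only [pow_succ, mul_apply]
    exact (le_iff_le _).2 h

theorem antitone_pow_apply (f : HomeoPlus) {x : unitInterval} (h : f x ≤ x) :
    Antitone fun n : ℕ => (f ^ n) x :=
  antitone_nat_of_succ_le fun n => by
    simp only [pow_succ, mul_apply]
    exact (le_iff_le _).2 h

theorem apply_eq_self_of_tendsto_pow (f : HomeoPlus) {x y : unitInterval}
    (h : Tendsto (fun n : ℕ => (f ^ n) x) atTop (𝓝 y)) : f y = y := by
  have h1 : Tendsto (fun n : ℕ => (f ^ (n + 1)) x) atTop (𝓝 (f y)) := by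
    simp only [pow_succ', mul_apply]
    exact ((continuous_coe f).tendsto y).comp h
  exact tendsto_nhds_unique h1 (h.comp (tendsto_add_atTop_nat 1))

/-- If `f` moves every point of `[x, y]` to the right, some power of `f` moves `x` beyond `y`. -/
theorem exists_lt_pow_apply (f : HomeoPlus) {x y : unitInterval}
    (h : ∀ z, x ≤ z → z ≤ y → z < f z) : ∃ n : ℕ, y < (f ^ n) x := by
  by_contra! hc
  have hxy : x ≤ y := hc 0
  have hm := monotone_pow_apply f (h x le_rfl hxy).le
  have hlim := tendsto_atTop_ciSup hm ⟨y, by rintro _ ⟨n, rfl⟩; exact hc n⟩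
  have h1 := apply_eq_self_of_tendsto_pow f hlim
  refine (h _ (hm.ge_of_tendsto hlim 0) (le_of_tendsto' hlim hc)).ne' h1

/-- If `f` moves every point of `[y, x]` to the left, some power of `f` moves `x` below `y`. -/
theorem exists_pow_apply_lt (f : HomeoPlus) {x y : unitInterval}
    (h : ∀ z, y ≤ z → z ≤ x → f z < z) : ∃ n : ℕ, (f ^ n) x < y := by
  by_contra! hc
  have hxy : y ≤ x := hc 0
  have hm := antitone_pow_apply f (h x hxy le_rfl).le
  have hlim := tendsto_atTop_ciInf hm ⟨y, by rintro _ ⟨n, rfl⟩; exact hc n⟩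
  have h1 := apply_eq_self_of_tendsto_pow f hlim
  refine (h _ (ge_of_tendsto' hlim hc) (hm.le_of_tendsto hlim 0)).ne h1

/-- The supremum of an orbit of a group of order automorphisms is a global fixed point. -/
theorem exists_lt_apply_of_forall {G : Type*} [Group G] (ψ : G →* HomeoPlus) {x y : unitInterval}
    (h : ∀ z, x ≤ z → z ≤ y → ∃ g, ψ g z ≠ z) : ∃ g, y < ψ g x := by
  by_contra! hc
  have hb : BddAbove (Set.range fun g => ψ g x) := ⟨y, by rintro _ ⟨g, rfl⟩; exact hc g⟩
  set s := ⨆ g, ψ g x with hs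
  have hle : ∀ g k, ψ g (ψ k x) ≤ s := by
    intro g k
    rw [← mul_apply, ← map_mul]
    exact le_ciSup hb (g * k)
  have hle' : ∀ g, s ≤ ψ g s := by
    intro g
    refine ciSup_le fun k => ?_
    have := hle g⁻¹ k
    rwa [map_inv, inv_le_iff] at this
  have hfix : ∀ g, ψ g s = s := by
    intro g
    refine le_antisymm ?_ (hle' g)
    have := hle' g⁻¹
    rwa [map_inv, le_inv_iff] at this
  have h1 : x ≤ s := by
    have := le_ciSup hb 1
    simpa [one_apply] using this
  obtain ⟨g, hg⟩ := h s h1 (ciSup_le hc)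
  exact hg (hfix g)

/-! ### `C¹` diffeomorphisms near an accumulation point of fixed points -/

/-- Fixed points accumulating at `x` make some difference quotients at `x` equal to 1, so the
derivative there is 1. By continuity it is within `ε` of 1 nearby, and the mean value inequality
makes the displacement `ε`-Lipschitz. -/
theorem IsC1.eventually_near_identity {f : HomeoPlus} (hf : IsC1 f) {x : unitInterval}
    {t : ℕ → unitInterval} (ht : Tendsto t atTop (𝓝 x)) (hne : ∀ n, t n ≠ x)
    (hfix : ∀ n, f (t n) = t n) {ε : ℝ} (hε : 0 < ε) :
    ∃ U ∈ 𝓝 x, ∀ y ∈ U, ∀ z ∈ U,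
      |((f y : ℝ) - y) - ((f z : ℝ) - z)| ≤ ε * |(y : ℝ) - z| := by
  have hfx : f x = x := by
    have h1 := ((continuous_coe f).tendsto x).comp ht
    exact tendsto_nhds_unique h1 (ht.congr fun n => (hfix n).symm)
  set S : Set ℝ := Set.Icc 0 1
  have hu : UniqueDiffOn ℝ S := uniqueDiffOn_Icc zero_lt_one
  have hd : ∀ y ∈ S, HasDerivWithinAt (toReal f) (derivWithin (toReal f) S y) S y := fun y hy =>
    ((hf.differentiableOn one_ne_zero) y hy).hasDerivWithinAt
  have hcont : ContinuousOn (derivWithin (toReal f) S) S := hf.continuousOn_derivWithin hu le_rfl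
  have htR : Tendsto (fun n => (t n : ℝ)) atTop (𝓝[S \ {(x : ℝ)}] x) := by
    refine tendsto_nhdsWithin_iff.2 ⟨(continuous_subtype_val.tendsto x).comp ht, ?_⟩
    exact Eventually.of_forall fun n => ⟨(t n).2, fun h => hne n (Subtype.ext h)⟩
  have hone : derivWithin (toReal f) S x = 1 := by
    have h1 := (hasDerivWithinAt_iff_tendsto_slope.1 (hd x x.2)).comp htR
    refine tendsto_nhds_unique h1 (tendsto_const_nhds.congr fun n => ?_)
    have h2 : (t n : ℝ) - x ≠ 0 := sub_ne_zero.2 fun h => hne n (Subtype.ext h)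
    simp only [Function.comp, slope_def_field, toReal_coe, hfix, hfx]
    rw [div_self h2]
  have hnear : ∀ᶠ y in 𝓝[S] (x : ℝ), |derivWithin (toReal f) S y - 1| < ε := by
    have h1 := (hcont x x.2).tendsto
    rw [hone] at h1
    have := h1.eventually (Metric.ball_mem_nhds 1 hε)
    simpa [Real.dist_eq] using this
  obtain ⟨δ, hδ, hball⟩ := Metric.mem_nhdsWithin_iff.1 hnear
  refine ⟨Metric.ball x δ, Metric.ball_mem_nhds x hδ, fun y hy z hz => ?_⟩
  have hconv : Convex ℝ (Metric.ball (x : ℝ) δ ∩ S) := (convex_ball _ _).inter (convex_Icc 0 1)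
  have key := hconv.norm_image_sub_le_of_norm_hasDerivWithin_le
    (f := fun y => toReal f y - y) (f' := fun y => derivWithin (toReal f) S y - 1) (C := ε)
    (x := z) (y := y)
    (fun w hw => ((hd w hw.2).sub (hasDerivWithinAt_id w S)).mono Set.inter_subset_right)
    (fun w hw => (hball hw).le) ⟨hz, z.2⟩ ⟨hy, y.2⟩
  simpa [toReal_coe, Real.norm_eq_abs] using key

/-- Two `C¹` diffeomorphisms cannot jump in opposite directions over each other's fixed points
arbitrarily close to a common fixed point. -/
theorem IsC1.eventually_not_opposite_jumps {f g : HomeoPlus} (hf : IsC1 f) (hg : IsC1 g)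
    {x : unitInterval} (hfx : f x = x) (hgx : g x = x) :
    ∀ᶠ y in 𝓝 x, ¬ (f y < y ∧ y < g y ∧ g (f y) = f y ∧ f (g y) = g y) := by
  by_contra hcon
  obtain ⟨y, hy, hjump⟩ := exists_seq_forall_of_frequently (not_eventually.1 hcon)
  simp only [not_not] at hjump
  have hfy : Tendsto (fun n => f (y n)) atTop (𝓝 x) := by
    have := ((continuous_coe f).tendsto x).comp hy
    rwa [hfx] at this
  have hgy : Tendsto (fun n => g (y n)) atTop (𝓝 x) := by
    have := ((continuous_coe g).tendsto x).comp hy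
    rwa [hgx] at this
  obtain ⟨U, hU, hUf⟩ := hf.eventually_near_identity hgy
    (fun n h => by
      have h1 : y n = x := g.injective (h.trans hgx.symm)
      have := (hjump n).2.1
      rw [h, h1] at this
      exact lt_irrefl _ this)
    (fun n => (hjump n).2.2.2) (ε := 1 / 4) (by norm_num)
  obtain ⟨V, hV, hVg⟩ := hg.eventually_near_identity hfy
    (fun n h => by
      have h1 : y n = x := f.injective (h.trans hfx.symm)
      have := (hjump n).1
      rw [h, h1] at this
      exact lt_irrefl _ this)
    (fun n => (hjump n).2.2.1) (ε := 1 / 4) (by norm_num)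
  have hev := (hy.eventually (inter_mem hU hV)).and
    ((hfy.eventually (inter_mem hU hV)).and (hgy.eventually (inter_mem hU hV)))
  obtain ⟨n, h1, h2, h3⟩ := hev.exists
  obtain ⟨j1, j2, j3, j4⟩ := hjump n
  -- Since `f` does not displace `g y`, the bound reads `y - f y ≤ (g y - y) / 4`; symmetrically `g
  -- y - y ≤ (y - f y) / 4`. Both lengths are positive, so any constant below 1 would give the
  -- contradiction.
  have k1 := hUf _ h1.1 _ h3.1
  have k2 := hVg _ h1.2 _ h2.2
  rw [j4] at k1
  rw [j3] at k2
  have j1' : (f (y n) : ℝ) < y n := j1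
  have j2' : (y n : ℝ) < g (y n) := j2
  rw [abs_of_nonpos (by linarith), abs_of_nonpos (by linarith)] at k1
  rw [abs_of_nonneg (by linarith), abs_of_nonneg (by linarith)] at k2
  linarith

/-- An interval `[a, b]` with two disjoint images inside itself, together with an invariant
interval `[u, v]` around it, cannot be pushed to infinitely many disjoint places by a
homeomorphism commuting with both `C¹` maps. -/
theorem IsC1.false_of_crossing {f₁ f₂ : HomeoPlus} (h₁ : IsC1 f₁) (h₂ : IsC1 f₂)
    {u v a b : unitInterval} (huv : u < v)
    (hf₁u : f₁ u = u) (hf₂u : f₂ u = u) (hua : u ≤ a) (hab' : a ≤ b) (hbv : b ≤ v)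
    (ha : a < f₁ a) (hab : f₁ b < f₂ a) (hb : f₂ b < b)
    {g : HomeoPlus} (hc₁ : Commute g f₁) (hc₂ : Commute g f₂) (hg : g v ≤ u) : False := by
  have hgu : g u < u := ((lt_iff_lt g).2 huv).trans_le hg
  have hanti := antitone_pow_apply g hgu.le
  obtain ⟨y, hy⟩ : ∃ y, Tendsto (fun n : ℕ => (g ^ n) u) atTop (𝓝 y) :=
    ⟨_, tendsto_atTop_ciInf hanti ⟨0, by rintro _ ⟨n, rfl⟩; exact bot_le⟩⟩
  -- The intervals `g ^ n [u, v]` follow one another downwards, possibly touching, so they shrink to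
  -- the limit `y` of their left endpoints. Those endpoints are fixed by `f₁` and `f₂`, which are
  -- therefore tangent to the identity at `y`.
  have hv : Tendsto (fun n : ℕ => (g ^ n) v) atTop (𝓝 y) := by
    rw [← tendsto_add_atTop_iff_nat 1]
    refine tendsto_of_tendsto_of_tendsto_of_le_of_le (hy.comp (tendsto_add_atTop_nat 1)) hy ?_ ?_
    · intro n
      exact (le_iff_le _).2 huv.le
    · intro n
      simp only [pow_succ, mul_apply]
      exact (le_iff_le _).2 hg
  have hne : ∀ n : ℕ, (g ^ n) u ≠ y := by
    intro n h
    have h1 : y ≤ (g ^ (n + 1)) u := hanti.le_of_tendsto hy (n + 1)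
    rw [pow_succ, mul_apply, ← h, le_iff_le] at h1
    exact absurd hgu (not_lt.2 h1)
  have hcomm : ∀ {f : HomeoPlus}, Commute g f → ∀ (n : ℕ) (z : unitInterval),
      f ((g ^ n) z) = (g ^ n) (f z) := by
    intro f hf n z
    rw [← mul_apply, ← mul_apply, (hf.pow_left n).eq]
  have hsq : ∀ z, u ≤ z → z ≤ v → Tendsto (fun n : ℕ => (g ^ n) z) atTop (𝓝 y) := fun z hz hz' =>
    tendsto_of_tendsto_of_tendsto_of_le_of_le hy hv (fun n => (le_iff_le _).2 hz)
      (fun n => (le_iff_le _).2 hz')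
  obtain ⟨U, hU, hU1⟩ := h₁.eventually_near_identity hy hne
    (fun n => by rw [hcomm hc₁, hf₁u]) (ε := 1 / 4) (by norm_num)
  obtain ⟨V, hV, hV1⟩ := h₂.eventually_near_identity hy hne
    (fun n => by rw [hcomm hc₂, hf₂u]) (ε := 1 / 4) (by norm_num)
  obtain ⟨n, hn1, hn2⟩ := (((hsq a hua (hab'.trans hbv)).eventually (inter_mem hU hV)).and
    ((hsq b (hua.trans hab') hbv).eventually (inter_mem hU hV))).exists
  -- With `ε = 1/4` each map retains at least 3/4 of the length of `g ^ n [a, b]`, yet both images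
  -- are disjoint inside that interval. Any constant up to 1/2 would do.
  have k1 := hU1 _ hn2.1 _ hn1.1
  have k2 := hV1 _ hn2.2 _ hn1.2
  rw [hcomm hc₁, hcomm hc₁] at k1
  rw [hcomm hc₂, hcomm hc₂] at k2
  have e1 : ((g ^ n) a : ℝ) < (g ^ n) (f₁ a) := (lt_iff_lt (g ^ n)).2 ha
  have e2 : ((g ^ n) (f₁ b) : ℝ) < (g ^ n) (f₂ a) := (lt_iff_lt (g ^ n)).2 hab
  have e3 : ((g ^ n) (f₂ b) : ℝ) < (g ^ n) b := (lt_iff_lt (g ^ n)).2 hb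
  have e4 : ((g ^ n) a : ℝ) ≤ (g ^ n) b := (le_iff_le (g ^ n)).2 hab'
  rw [abs_of_nonneg (sub_nonneg.2 e4)] at k1 k2
  have k1' := (abs_le.1 k1).1
  have k2' := (abs_le.1 k2).1
  linarith


/-! ### Elements and self-embeddings of Thompson's group -/

theorem IsDyadic.one : IsDyadic 1 := ⟨1, 0, by simp⟩

theorem IsDyadic.half {x : ℝ} (hx : IsDyadic x) : IsDyadic (x / 2) := by
  have := hx.zpow_mul (-1)
  rwa [zpow_neg, zpow_one, inv_mul_eq_div] at this

theorem IsDyadic.double {x : ℝ} (hx : IsDyadic x) : IsDyadic (2 * x) := by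
  have := hx.zpow_mul 1
  rwa [zpow_one] at this

/-- The standard generator of `F`, moving all points of `(0,1)` to the right. -/
noncomputable def shiftHomeo : HomeoPlus where
  toFun x := ⟨min (2 * (x : ℝ)) (min ((x : ℝ) + 1 / 4) (((x : ℝ) + 1) / 2)), by
    have h0 := x.2.1
    have h1 := x.2.2
    constructor
    · refine le_min ?_ (le_min ?_ ?_) <;> linarith
    · refine (min_le_right _ _).trans ((min_le_right _ _).trans ?_); linarith⟩
  invFun x := ⟨max ((x : ℝ) / 2) (max ((x : ℝ) - 1 / 4) (2 * (x : ℝ) - 1)), by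
    have h0 := x.2.1
    have h1 := x.2.2
    constructor
    · refine le_trans ?_ (le_max_left _ _); linarith
    · refine max_le ?_ (max_le ?_ ?_) <;> linarith⟩
  left_inv x := by
    ext
    simp only
    rcases min_cases (2 * (x : ℝ)) (min ((x : ℝ) + 1 / 4) (((x : ℝ) + 1) / 2)) with h | h <;>
    rcases min_cases ((x : ℝ) + 1 / 4) (((x : ℝ) + 1) / 2) with h' | h' <;>
    rw [h.1] <;> try rw [h'.1]
    all_goals
      rw [h'.1] at h
      apply le_antisymm
      · refine max_le ?_ (max_le ?_ ?_) <;> linarith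
      · simp only [le_max_iff]
        first
        | left; linarith
        | right; left; linarith
        | right; right; linarith
  right_inv x := by
    ext
    simp only
    rcases max_cases ((x : ℝ) / 2) (max ((x : ℝ) - 1 / 4) (2 * (x : ℝ) - 1)) with h | h <;>
    rcases max_cases ((x : ℝ) - 1 / 4) (2 * (x : ℝ) - 1) with h' | h' <;>
    rw [h.1] <;> try rw [h'.1]
    all_goals
      rw [h'.1] at h
      apply le_antisymm
      · simp only [min_le_iff]
        first
        | left; linarith
        | right; left; linarith
        | right; right; linarith
      · refine le_min ?_ (le_min ?_ ?_) <;> linarith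
  map_rel_iff' {x y} := by
    have key : ∀ {x y : ℝ}, x < y → min (2 * x) (min (x + 1 / 4) ((x + 1) / 2)) <
        min (2 * y) (min (y + 1 / 4) ((y + 1) / 2)) := by
      intro x y h
      refine lt_min ?_ (lt_min ?_ ?_)
      · exact (min_le_left _ _).trans_lt (by linarith)
      · exact ((min_le_right _ _).trans (min_le_left _ _)).trans_lt (by linarith)
      · exact ((min_le_right _ _).trans (min_le_right _ _)).trans_lt (by linarith)
    constructor
    · intro h
      by_contra! h'
      exact absurd h (not_le.2 (key h'))
    · intro h
      rcases eq_or_lt_of_le h with h | h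
      · rw [h]
      · exact (key h).le

theorem coe_shiftHomeo (x : unitInterval) :
    (shiftHomeo x : ℝ) = min (2 * (x : ℝ)) (min ((x : ℝ) + 1 / 4) (((x : ℝ) + 1) / 2)) := rfl

theorem shiftHomeo_of_le {x : unitInterval} (h : (x : ℝ) ≤ 1 / 4) :
    (shiftHomeo x : ℝ) = 2 * x := by
  rw [coe_shiftHomeo, min_eq_left]
  refine le_min ?_ ?_ <;> linarith

theorem shiftHomeo_of_mem {x : unitInterval} (h : 1 / 4 ≤ (x : ℝ)) (h' : (x : ℝ) ≤ 1 / 2) :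
    (shiftHomeo x : ℝ) = x + 1 / 4 := by
  rw [coe_shiftHomeo, min_eq_left (a := (x : ℝ) + 1 / 4) (by linarith), min_eq_right (by linarith)]

theorem shiftHomeo_of_ge {x : unitInterval} (h : 1 / 2 ≤ (x : ℝ)) :
    (shiftHomeo x : ℝ) = (x + 1) / 2 := by
  rw [coe_shiftHomeo, min_eq_right (a := (x : ℝ) + 1 / 4) (by linarith), min_eq_right (by linarith)]

theorem lt_shiftHomeo {x : unitInterval} (h0 : 0 < x) (h1 : x < 1) : x < shiftHomeo x := by
  have h0' : (0 : ℝ) < x := h0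
  have h1' : (x : ℝ) < 1 := h1
  change (x : ℝ) < shiftHomeo x
  rw [coe_shiftHomeo]
  refine lt_min ?_ (lt_min ?_ ?_) <;> linarith

theorem isThompson_shiftHomeo : IsThompson shiftHomeo := by
  refine ⟨{⟨1 / 4, by norm_num, by norm_num⟩, ⟨1 / 2, by norm_num, by norm_num⟩}, ?_, ?_⟩
  · intro x hx
    rcases Finset.mem_insert.1 hx with rfl | hx
    · exact ⟨1, 2, by norm_num⟩
    · rw [Finset.mem_singleton.1 hx]
      exact ⟨1, 1, by norm_num⟩
  · intro a b hab
    have h1 := hab ⟨1 / 4, by norm_num, by norm_num⟩ (by simp)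
    have h2 := hab ⟨1 / 2, by norm_num, by norm_num⟩ (by simp)
    have h1' : ¬ ((a : ℝ) < 1 / 4 ∧ 1 / 4 < (b : ℝ)) := h1
    have h2' : ¬ ((a : ℝ) < 1 / 2 ∧ 1 / 2 < (b : ℝ)) := h2
    rcases le_or_gt (b : ℝ) (1 / 4) with hb | hb
    · refine ⟨1, 0, fun x hx => ?_⟩
      have : (x : ℝ) ≤ b := hx.2
      rw [shiftHomeo_of_le (by linarith), zpow_one, add_zero]
    rcases le_or_gt (b : ℝ) (1 / 2) with hb' | hb'
    · refine ⟨0, 1 / 4, fun x hx => ?_⟩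
      have h3 : (x : ℝ) ≤ b := hx.2
      have h4 : (a : ℝ) ≤ x := hx.1
      have h5 : 1 / 4 ≤ (a : ℝ) := by by_contra! h; exact h1' ⟨h, hb⟩
      rw [shiftHomeo_of_mem (by linarith) (by linarith), zpow_zero, one_mul]
    · refine ⟨-1, 1 / 2, fun x hx => ?_⟩
      have h4 : (a : ℝ) ≤ x := hx.1
      have h5 : 1 / 2 ≤ (a : ℝ) := by by_contra! h; exact h2' ⟨h, hb'⟩
      rw [shiftHomeo_of_ge (by linarith), zpow_neg, zpow_one]
      ring

/-- The standard generator of `F`, as an element of `F`. -/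
noncomputable def shift : F := ⟨shiftHomeo, isThompson_shiftHomeo⟩

/-- Conjugation by the reflection of the interval. -/
def flipHomeo : HomeoPlus →* HomeoPlus where
  toFun f :=
    { toFun := fun x => unitInterval.symm (f (unitInterval.symm x))
      invFun := fun x => unitInterval.symm (f.symm (unitInterval.symm x))
      left_inv := fun x => by simp
      right_inv := fun x => by simp
      map_rel_iff' := by simp }
  map_one' := by
    ext x
    change ((unitInterval.symm (unitInterval.symm x) : unitInterval) : ℝ) = x
    simp
  map_mul' f g := by
    ext x
    change ((unitInterval.symm (f (g (unitInterval.symm x))) : unitInterval) : ℝ) =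
      unitInterval.symm (f (unitInterval.symm (unitInterval.symm (g (unitInterval.symm x)))))
    rw [unitInterval.symm_symm]

theorem flipHomeo_apply (f : HomeoPlus) (x : unitInterval) :
    flipHomeo f x = unitInterval.symm (f (unitInterval.symm x)) := rfl

theorem flipHomeo_flipHomeo (f : HomeoPlus) : flipHomeo (flipHomeo f) = f := by
  ext x
  simp [flipHomeo_apply]

theorem IsThompson.flip {f : HomeoPlus} (hf : IsThompson f) : IsThompson (flipHomeo f) := by
  obtain ⟨s, hs, hpl⟩ := hf
  refine ⟨s.image unitInterval.symm, ?_, ?_⟩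
  · intro x hx
    obtain ⟨y, hy, rfl⟩ := Finset.mem_image.1 hx
    rw [unitInterval.coe_symm_eq, sub_eq_add_neg]
    exact IsDyadic.one.add (hs y hy).neg
  · intro a b hab
    obtain ⟨k, c, hkc⟩ := hpl (unitInterval.symm b) (unitInterval.symm a) (by
      intro x hx hx'
      refine hab _ (Finset.mem_image_of_mem _ hx) ⟨?_, ?_⟩
      · exact unitInterval.lt_symm_comm.1 hx'.2
      · exact unitInterval.symm_lt_comm.1 hx'.1)
    refine ⟨k, 1 - (2 : ℝ) ^ k - c, fun x hx => ?_⟩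
    rw [flipHomeo_apply, unitInterval.coe_symm_eq,
      hkc _ ⟨unitInterval.symm_le_symm.2 hx.2, unitInterval.symm_le_symm.2 hx.1⟩,
      unitInterval.coe_symm_eq]
    ring

/-- The automorphism of `F` given by the reflection of the interval. -/
def flip : F →* F := (flipHomeo.comp thompson.subtype).codRestrict thompson fun f => f.2.flip

theorem flip_flip (f : F) : flip (flip f) = f := Subtype.ext (flipHomeo_flipHomeo f)

theorem flip_injective : Function.Injective flip :=
  (show Function.Involutive flip from flip_flip).injective

/-- The point `x / 2`. -/
noncomputable def halve (x : unitInterval) : unitInterval :=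
  ⟨(x : ℝ) / 2, by have := x.2.1; linarith, by have := x.2.2; linarith⟩

/-- The point `2 x`, truncated at `1`. -/
noncomputable def dbl (x : unitInterval) : unitInterval :=
  ⟨min (2 * (x : ℝ)) 1, le_min (by have := x.2.1; linarith) zero_le_one, min_le_right _ _⟩

theorem coe_halve (x : unitInterval) : (halve x : ℝ) = x / 2 := rfl

theorem coe_halve_le (x : unitInterval) : (halve x : ℝ) ≤ 1 / 2 := by
  have := x.2.2
  rw [coe_halve]; linarith

theorem coe_dbl {x : unitInterval} (h : (x : ℝ) ≤ 1 / 2) : (dbl x : ℝ) = 2 * x :=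
  min_eq_left (by linarith)

theorem dbl_halve (x : unitInterval) : dbl (halve x) = x := by
  ext
  rw [coe_dbl (coe_halve_le x), coe_halve]; ring

theorem halve_dbl {x : unitInterval} (h : (x : ℝ) ≤ 1 / 2) : halve (dbl x) = x := by
  ext
  rw [coe_halve, coe_dbl h]; ring

theorem halve_lt_halve {x y : unitInterval} : halve x < halve y ↔ x < y := by
  change (x : ℝ) / 2 < y / 2 ↔ (x : ℝ) < y
  constructor <;> intro h <;> linarith

theorem halve_le_halve {x y : unitInterval} : halve x ≤ halve y ↔ x ≤ y := by
  change (x : ℝ) / 2 ≤ y / 2 ↔ (x : ℝ) ≤ y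
  constructor <;> intro h <;> linarith

open Classical in
/-- `f`, rescaled to the left half of the interval. -/
noncomputable def leftFun (f : HomeoPlus) (x : unitInterval) : unitInterval :=
  if (x : ℝ) ≤ 1 / 2 then halve (f (dbl x)) else x

theorem leftFun_halve (f : HomeoPlus) (x : unitInterval) :
    leftFun f (halve x) = halve (f x) := by
  rw [leftFun, if_pos (coe_halve_le x), dbl_halve]

theorem leftFun_of_ge (f : HomeoPlus) {x : unitInterval} (h : 1 / 2 ≤ (x : ℝ)) :
    leftFun f x = x := by
  rcases eq_or_lt_of_le h with h | h
  · have h1 : x = halve 1 := by ext; rw [coe_halve, ← h]; simp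
    rw [h1, leftFun_halve, apply_one]
  · rw [leftFun, if_neg (not_le.2 h)]

theorem eq_halve_or_ge (x : unitInterval) : (∃ y, x = halve y) ∨ 1 / 2 ≤ (x : ℝ) := by
  rcases le_total (x : ℝ) (1 / 2) with h | h
  · exact Or.inl ⟨dbl x, (halve_dbl h).symm⟩
  · exact Or.inr h

theorem leftFun_mul (f g : HomeoPlus) (x : unitInterval) :
    leftFun (f * g) x = leftFun f (leftFun g x) := by
  rcases eq_halve_or_ge x with ⟨y, rfl⟩ | h
  · simp only [leftFun_halve, mul_apply]
  · rw [leftFun_of_ge _ h, leftFun_of_ge g h, leftFun_of_ge _ h]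

theorem leftFun_one (x : unitInterval) : leftFun 1 x = x := by
  rcases eq_halve_or_ge x with ⟨y, rfl⟩ | h
  · rw [leftFun_halve, one_apply]
  · rw [leftFun_of_ge _ h]

theorem leftFun_mono (f : HomeoPlus) : Monotone (leftFun f) := by
  intro x y hxy
  rcases eq_halve_or_ge x with ⟨x, rfl⟩ | hx <;> rcases eq_halve_or_ge y with ⟨y, rfl⟩ | hy
  · rw [leftFun_halve, leftFun_halve, halve_le_halve, le_iff_le]
    exact halve_le_halve.1 hxy
  · rw [leftFun_halve, leftFun_of_ge _ hy]
    exact (coe_halve_le _).trans hy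
  · rw [leftFun_of_ge _ hx, leftFun_halve]
    have h1 : halve y = halve 1 := by
      refine le_antisymm (halve_le_halve.2 le_top) ?_
      refine le_trans ?_ hxy
      change ((1 : unitInterval) : ℝ) / 2 ≤ x
      simpa using hx
    have h2 : y = 1 := by rw [← dbl_halve y, h1, dbl_halve]
    rw [h2, apply_one, ← h1]
    exact hxy
  · rw [leftFun_of_ge _ hx, leftFun_of_ge _ hy]
    exact hxy

/-- Rescaling a homeomorphism to the left half of the interval. -/
noncomputable def leftHomeo : HomeoPlus →* HomeoPlus where
  toFun f :=
    { toFun := leftFun f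
      invFun := leftFun f⁻¹
      left_inv := fun x => by rw [← leftFun_mul, inv_mul_cancel, leftFun_one]
      right_inv := fun x => by rw [← leftFun_mul, mul_inv_cancel, leftFun_one]
      map_rel_iff' := by
        intro x y
        refine ⟨fun h => ?_, fun h => leftFun_mono f h⟩
        have := leftFun_mono f⁻¹ h
        simpa only [Equiv.coe_fn_mk, ← leftFun_mul, inv_mul_cancel, leftFun_one] using this }
  map_one' := by ext x; exact congrArg _ (leftFun_one x)
  map_mul' f g := by ext x; exact congrArg _ (leftFun_mul f g x)

theorem leftHomeo_halve (f : HomeoPlus) (x : unitInterval) :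
    leftHomeo f (halve x) = halve (f x) := leftFun_halve f x

theorem leftHomeo_of_ge (f : HomeoPlus) {x : unitInterval} (h : 1 / 2 ≤ (x : ℝ)) :
    leftHomeo f x = x := leftFun_of_ge f h

theorem IsThompson.left {f : HomeoPlus} (hf : IsThompson f) : IsThompson (leftHomeo f) := by
  obtain ⟨s, hs, hpl⟩ := hf
  refine ⟨insert (halve 1) (s.image halve), ?_, ?_⟩
  · intro x hx
    rcases Finset.mem_insert.1 hx with rfl | hx
    · exact IsDyadic.one.half
    · obtain ⟨y, hy, rfl⟩ := Finset.mem_image.1 hx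
      exact (hs y hy).half
  · intro a b hab
    have h1 := hab _ (Finset.mem_insert_self _ _)
    have h1' : ¬ ((a : ℝ) < ((1 : unitInterval) : ℝ) / 2 ∧ ((1 : unitInterval) : ℝ) / 2 < b) := h1
    rw [Set.Icc.coe_one] at h1'
    rcases le_or_gt (1 / 2) (a : ℝ) with ha | ha
    · refine ⟨0, 0, fun x hx => ?_⟩
      rw [leftHomeo_of_ge f (ha.trans hx.1)]
      simp
    · have hb : (b : ℝ) ≤ 1 / 2 := by by_contra! h; exact h1' ⟨ha, h⟩
      have hda := halve_dbl ha.le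
      have hdb := halve_dbl hb
      obtain ⟨k, c, hkc⟩ := hpl (dbl a) (dbl b) (by
        intro x hx hx'
        refine hab (halve x) (Finset.mem_insert_of_mem (Finset.mem_image_of_mem _ hx)) ⟨?_, ?_⟩
        · rw [← hda, halve_lt_halve]; exact hx'.1
        · rw [← hdb, halve_lt_halve]; exact hx'.2)
      refine ⟨k, c / 2, fun x hx => ?_⟩
      have hx2 : (x : ℝ) ≤ 1 / 2 := le_trans hx.2 hb
      have hdx := halve_dbl hx2
      rw [← hdx, leftHomeo_halve, coe_halve, coe_halve, hkc]
      · ring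
      · refine ⟨halve_le_halve.1 ?_, halve_le_halve.1 ?_⟩
        · rw [hda, hdx]; exact hx.1
        · rw [hdb, hdx]; exact hx.2

/-- The isomorphism of `F` with `F₋`, as an endomorphism of `F`. -/
noncomputable def toLeft : F →* F :=
  (leftHomeo.comp thompson.subtype).codRestrict thompson fun f => f.2.left

/-- The isomorphism of `F` with `F₊`, as an endomorphism of `F`. -/
noncomputable def toRight : F →* F := (flip.comp toLeft).comp flip

theorem toLeft_halve (f : F) (x : unitInterval) :
    (toLeft f : HomeoPlus) (halve x) = halve ((f : HomeoPlus) x) := leftHomeo_halve f x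

theorem toLeft_of_ge (f : F) {x : unitInterval} (h : 1 / 2 ≤ (x : ℝ)) :
    (toLeft f : HomeoPlus) x = x := leftHomeo_of_ge f h

theorem flip_apply (f : F) (x : unitInterval) :
    (flip f : HomeoPlus) x = unitInterval.symm ((f : HomeoPlus) (unitInterval.symm x)) := rfl

theorem toRight_apply (f : F) (x : unitInterval) :
    (toRight f : HomeoPlus) x =
      unitInterval.symm ((toLeft (flip f) : HomeoPlus) (unitInterval.symm x)) := rfl

theorem toRight_of_le (f : F) {x : unitInterval} (h : (x : ℝ) ≤ 1 / 2) :
    (toRight f : HomeoPlus) x = x := by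
  rw [toRight_apply, toLeft_of_ge _ ((unitInterval.half_le_symm_iff x).2 h),
    unitInterval.symm_symm]

theorem F_ext {f g : F} (h : ∀ x, (f : HomeoPlus) x = (g : HomeoPlus) x) : f = g :=
  Subtype.ext (DFunLike.ext _ _ h)

theorem toLeft_injective : Function.Injective toLeft := by
  intro f g h
  refine F_ext fun x => ?_
  have h1 := toLeft_halve f x
  rw [h, toLeft_halve] at h1
  rw [← dbl_halve ((f : HomeoPlus) x), ← h1, dbl_halve]

theorem toRight_injective : Function.Injective toRight :=
  (flip_injective.comp toLeft_injective).comp flip_injective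

theorem commute_toLeft_toRight (f g : F) : Commute (toLeft f) (toRight g) := by
  have key : ∀ f g : F, ∀ x : unitInterval, (x : ℝ) ≤ 1 / 2 →
      (toLeft f : HomeoPlus) ((toRight g : HomeoPlus) x) =
        (toRight g : HomeoPlus) ((toLeft f : HomeoPlus) x) := by
    intro f g x h
    rw [toRight_of_le g h, toRight_of_le g]
    obtain ⟨y, rfl⟩ : ∃ y, x = halve y := ⟨_, (halve_dbl h).symm⟩
    rw [toLeft_halve]
    exact coe_halve_le _
  refine F_ext fun x => ?_
  change (toLeft f : HomeoPlus) ((toRight g : HomeoPlus) x) =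
    (toRight g : HomeoPlus) ((toLeft f : HomeoPlus) x)
  rcases le_total (x : ℝ) (1 / 2) with h | h
  · exact key f g x h
  · have h1 : ((unitInterval.symm x : unitInterval) : ℝ) ≤ 1 / 2 := by
      rw [unitInterval.coe_symm_eq]; linarith
    have h2 := key (flip g) (flip f) _ h1
    simp only [toRight_apply, flip_flip, unitInterval.symm_symm] at h2
    simp only [toRight_apply]
    rw [h2, unitInterval.symm_symm]

theorem apply_halve_one_of_mem_FMinus {g : F} (hg : g ∈ FMinus) :
    (g : HomeoPlus) (halve 1) = halve 1 := by
  by_contra hne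
  have hmoved : ∀ x : unitInterval, 1 / 2 < (x : ℝ) → (g : HomeoPlus) x = x := by
    intro x hx
    by_contra h
    exact absurd (hg x h) (not_le.2 hx)
  rcases lt_or_gt_of_ne hne with h | h
  · have h1 := (lt_inv_iff (g : HomeoPlus)).2 h
    have h1' : ((1 : unitInterval) : ℝ) / 2 < ((g : HomeoPlus)⁻¹ (halve 1) : unitInterval) := h1
    have h2 := hmoved _ (by simpa using h1')
    rw [apply_inv_apply] at h2
    exact h1.ne h2
  · have h' : ((1 : unitInterval) : ℝ) / 2 < ((g : HomeoPlus) (halve 1) : unitInterval) := h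
    have h2 := hmoved _ (by simpa using h')
    exact hne ((g : HomeoPlus).injective h2)

theorem exists_toLeft_eq {g : F} (hg : g ∈ FMinus) : ∃ f, toLeft f = g := by
  have hfix := apply_halve_one_of_mem_FMinus hg
  have hle : ∀ k : HomeoPlus, k (halve 1) = halve 1 → ∀ x, (k (halve x) : ℝ) ≤ 1 / 2 := by
    intro k hk x
    have h1 : k (halve x) ≤ halve 1 := by
      rw [← hk, le_iff_le, halve_le_halve]; exact le_top
    have h2 : ((k (halve x) : unitInterval) : ℝ) ≤ ((1 : unitInterval) : ℝ) / 2 := h1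
    simpa using h2
  have hfix' : (g : HomeoPlus)⁻¹ (halve 1) = halve 1 := (inv_apply_eq_self_iff _).2 hfix
  let f : HomeoPlus :=
    { toFun := fun x => dbl ((g : HomeoPlus) (halve x))
      invFun := fun x => dbl ((g : HomeoPlus)⁻¹ (halve x))
      left_inv := fun x => by
        simp only
        rw [halve_dbl (hle _ hfix x), inv_apply_apply, dbl_halve]
      right_inv := fun x => by
        simp only
        rw [halve_dbl (hle _ hfix' x), apply_inv_apply, dbl_halve]
      map_rel_iff' := by
        intro x y
        change dbl ((g : HomeoPlus) (halve x)) ≤ dbl ((g : HomeoPlus) (halve y)) ↔ x ≤ y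
        rw [← halve_le_halve, halve_dbl (hle _ hfix x), halve_dbl (hle _ hfix y), le_iff_le,
          halve_le_halve] }
  have hf : ∀ x, f x = dbl ((g : HomeoPlus) (halve x)) := fun _ => rfl
  have hfT : IsThompson f := by
    obtain ⟨s, hs, hpl⟩ := g.2
    refine ⟨(s.filter fun x : unitInterval => (x : ℝ) ≤ 1 / 2).image dbl, ?_, ?_⟩
    · intro x hx
      obtain ⟨y, hy, rfl⟩ := Finset.mem_image.1 hx
      obtain ⟨hy, hy'⟩ := Finset.mem_filter.1 hy
      rw [coe_dbl hy']
      exact (hs y hy).double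
    · intro a b hab
      obtain ⟨k, c, hkc⟩ := hpl (halve a) (halve b) (by
        intro x hx hx'
        have hx2 : (x : ℝ) ≤ 1 / 2 := le_trans hx'.2.le (coe_halve_le b)
        refine hab (dbl x)
          (Finset.mem_image_of_mem _ (Finset.mem_filter.2 ⟨hx, hx2⟩)) ⟨?_, ?_⟩
        · rw [← halve_lt_halve, halve_dbl hx2]; exact hx'.1
        · rw [← halve_lt_halve, halve_dbl hx2]; exact hx'.2)
      refine ⟨k, 2 * c, fun x hx => ?_⟩
      rw [hf, coe_dbl (hle _ hfix x), hkc _ ⟨halve_le_halve.2 hx.1, halve_le_halve.2 hx.2⟩,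
        coe_halve]
      ring
  refine ⟨⟨f, hfT⟩, F_ext fun x => ?_⟩
  rcases eq_halve_or_ge x with ⟨y, rfl⟩ | h
  · rw [toLeft_halve]
    change halve (f y) = _
    rw [hf, halve_dbl (hle _ hfix y)]
  · rw [toLeft_of_ge _ h]
    rcases eq_or_lt_of_le h with h | h
    · have h1 : x = halve 1 := by ext; rw [coe_halve, ← h]; simp
      rw [h1, hfix]
    · by_contra hne
      exact absurd (hg x (Ne.symm hne)) (not_le.2 h)

theorem exists_toRight_eq {g : F} (hg : g ∈ FPlus) : ∃ f, toRight f = g := by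
  have hg' : flip g ∈ FMinus := by
    intro x hx
    have h1 : (g : HomeoPlus) (unitInterval.symm x) ≠ unitInterval.symm x := by
      intro h
      rw [flip_apply, h, unitInterval.symm_symm] at hx
      exact hx rfl
    exact (unitInterval.half_le_symm_iff x).1 (hg _ h1)
  obtain ⟨f, hf⟩ := exists_toLeft_eq hg'
  refine ⟨flip f, ?_⟩
  change flip (toLeft (flip (flip f))) = g
  rw [flip_flip, hf, flip_flip]

theorem toLeft_mem (f : F) : toLeft f ∈ FMinus := by
  intro x hx
  by_contra h
  exact hx (toLeft_of_ge f (not_le.1 h).le)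

theorem toRight_mem (f : F) : toRight f ∈ FPlus := by
  intro x hx
  by_contra h
  exact hx (toRight_of_le f (not_le.1 h).le)

theorem map_toLeft_top : Subgroup.map toLeft ⊤ = FMinus := by
  ext g
  constructor
  · rintro ⟨f, -, rfl⟩
    exact toLeft_mem f
  · intro hg
    obtain ⟨f, rfl⟩ := exists_toLeft_eq hg
    exact ⟨f, trivial, rfl⟩

theorem map_toRight_top : Subgroup.map toRight ⊤ = FPlus := by
  ext g
  constructor
  · rintro ⟨f, -, rfl⟩
    exact toRight_mem f
  · intro hg
    obtain ⟨f, rfl⟩ := exists_toRight_eq hg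
    exact ⟨f, trivial, rfl⟩

theorem map_toLeft_commutator : Subgroup.map toLeft ⁅(⊤ : Subgroup F), (⊤ : Subgroup F)⁆ = ⁅FMinus, FMinus⁆ := by
  rw [Subgroup.map_commutator, map_toLeft_top]

theorem map_toRight_commutator : Subgroup.map toRight ⁅(⊤ : Subgroup F), (⊤ : Subgroup F)⁆ = ⁅FPlus, FPlus⁆ := by
  rw [Subgroup.map_commutator, map_toRight_top]


/-! ### Normal subgroups of Thompson's group -/

/-- Disjointness of supports is needed only at `x`, `f x` and `g x`; hence this form also applies
inside a single invariant interval when the supports meet elsewhere. -/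
theorem apply_comm_of_fixed {f g : HomeoPlus} {x : unitInterval} (h : f x = x ∨ g x = x)
    (hf : f (f x) = f x ∨ g (f x) = f x) (hg : f (g x) = g x ∨ g (g x) = g x) :
    f (g x) = g (f x) := by
  rcases eq_or_ne (f x) x with h1 | h1
  · rcases hg with h' | h'
    · rw [h1, h']
    · have h2 := g.injective h'
      rw [h2, h1, h2]
  · have h2 : g x = x := h.resolve_left h1
    have h3 : g (f x) = f x := hf.resolve_left fun h => h1 (f.injective h)
    rw [h2, h3]

theorem commute_of_forall_fixed {f g : HomeoPlus} (h : ∀ x, f x = x ∨ g x = x) : Commute f g :=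
  DFunLike.ext _ _ fun x => apply_comm_of_fixed (h x) (h (f x)) (h (g x))

theorem F_commute_of_forall_fixed {f g : F}
    (h : ∀ x, (f : HomeoPlus) x = x ∨ (g : HomeoPlus) x = x) : Commute f g :=
  Subtype.ext (commute_of_forall_fixed h)

/-- `f` is multiplication by `2 ^ m` near `0`. -/
def HasGerm (f : F) (m : ℤ) : Prop :=
  ∀ᶠ x : unitInterval in 𝓝 0, ((f : HomeoPlus) x : ℝ) = (2 : ℝ) ^ m * x

theorem HasGerm.mul {f g : F} {m n : ℤ} (hf : HasGerm f m) (hg : HasGerm g n) :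
    HasGerm (f * g) (m + n) := by
  have h0 : Tendsto (g : HomeoPlus) (𝓝 0) (𝓝 0) := by
    have := (continuous_coe (g : HomeoPlus)).tendsto 0
    rwa [apply_zero] at this
  filter_upwards [h0.eventually hf, hg] with x h1 h2
  rw [Subgroup.coe_mul, mul_apply, h1, h2, zpow_add₀ two_ne_zero]
  ring

theorem HasGerm.one : HasGerm 1 0 := Eventually.of_forall fun x => by simp [one_apply]

theorem HasGerm.inv {f : F} {m : ℤ} (hf : HasGerm f m) : HasGerm f⁻¹ (-m) := by
  have h0 : Tendsto ((f⁻¹ : F) : HomeoPlus) (𝓝 0) (𝓝 0) := by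
    have := (continuous_coe ((f⁻¹ : F) : HomeoPlus)).tendsto 0
    rwa [apply_zero] at this
  filter_upwards [h0.eventually hf] with x h1
  rw [Subgroup.coe_inv, apply_inv_apply] at h1
  rw [Subgroup.coe_inv, h1, zpow_neg]
  field_simp

theorem HasGerm.zpow {f : F} {m : ℤ} (hf : HasGerm f m) (k : ℤ) : HasGerm (f ^ k) (k * m) := by
  induction k with
  | zero => simpa using HasGerm.one
  | succ i ih => rw [zpow_add_one, add_mul, one_mul]; exact ih.mul hf
  | pred i ih => rw [zpow_sub_one, sub_mul, one_mul, sub_eq_add_neg]; exact ih.mul hf.inv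

theorem exists_hasGerm (f : F) : ∃ m, HasGerm f m := by
  obtain ⟨s, -, hs⟩ := f.2
  have h1 : ((s.erase 0 : Finset unitInterval) : Set unitInterval)ᶜ ∈ 𝓝 (0 : unitInterval) :=
    (Finset.finite_toSet _).isClosed.isOpen_compl.mem_nhds (by simp)
  obtain ⟨b, hb0, hb⟩ := exists_Ico_subset_of_mem_nhds h1 ⟨1, zero_lt_one⟩
  obtain ⟨k, c, hkc⟩ := hs 0 b (by
    intro x hx hx'
    refine hb ⟨hx'.1.le, hx'.2⟩ ?_
    simp [hx, hx'.1.ne'])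
  have hc := hkc 0 ⟨le_rfl, hb0.le⟩
  rw [apply_zero] at hc
  simp only [Set.Icc.coe_zero, mul_zero, zero_add] at hc
  refine ⟨k, ?_⟩
  filter_upwards [Iio_mem_nhds hb0] with x hx
  rw [hkc x ⟨bot_le, le_of_lt hx⟩, ← hc, add_zero]

/-- `f` is the identity near both endpoints of the interval. -/
def TrivialNearEnds (f : F) : Prop := HasGerm f 0 ∧ HasGerm (flip f) 0

theorem HasGerm.exists_forall_le {f : F} (h : HasGerm f 0) :
    ∃ p : unitInterval, 0 < p ∧ ∀ x ≤ p, (f : HomeoPlus) x = x := by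
  obtain ⟨b, hb0, hb⟩ := exists_Ico_subset_of_mem_nhds h ⟨1, zero_lt_one⟩
  obtain ⟨p, hp0, hp⟩ := exists_between hb0
  refine ⟨p, hp0, fun x hx => Subtype.ext ?_⟩
  have h1 := hb ⟨bot_le, hx.trans_lt hp⟩
  simpa using h1

theorem hasGerm_zero_of_forall_lt {f : F} {p : unitInterval} (hp : 0 < p)
    (h : ∀ x < p, (f : HomeoPlus) x = x) : HasGerm f 0 := by
  filter_upwards [Iio_mem_nhds hp] with x hx
  rw [h x hx, zpow_zero, one_mul]

theorem TrivialNearEnds.exists_bounds {f : F} (h : TrivialNearEnds f) :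
    ∃ p q : unitInterval, 0 < p ∧ q < 1 ∧
      ∀ x, (f : HomeoPlus) x = x ∨ (p < x ∧ x < q) := by
  obtain ⟨p, hp, hp'⟩ := h.1.exists_forall_le
  obtain ⟨q, hq, hq'⟩ := h.2.exists_forall_le
  refine ⟨p, unitInterval.symm q, hp, ?_, fun x => ?_⟩
  · rw [unitInterval.symm_lt_comm, unitInterval.symm_one]; exact hq
  · by_contra! hc
    have h1 : p < x := by
      by_contra! h1
      exact hc.1 (hp' x h1)
    have h2 := hq' _ (unitInterval.symm_le_comm.1 (hc.2 h1))
    rw [flip_apply, unitInterval.symm_symm, unitInterval.symm_inj] at h2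
    exact hc.1 h2

theorem shift_apply (x : unitInterval) : ((shift : F) : HomeoPlus) x = shiftHomeo x := rfl

theorem exists_lt_shift_pow {p q : unitInterval} (hp : 0 < p) (hq : q < 1) :
    ∃ n : ℕ, q < ((shift ^ n : F) : HomeoPlus) p :=
  exists_lt_pow_apply shiftHomeo fun _ h1 h2 => lt_shiftHomeo (hp.trans_le h1) (h2.trans_lt hq)

/-- The orbits of `F` in the open interval are dense. -/
theorem exists_abs_apply_sub_le (n : ℕ) (y z : unitInterval) (h0 : 0 < y) (h1 : y < 1) :
    ∃ f : F, |((f : HomeoPlus) y : ℝ) - z| ≤ (1 / 2) ^ n := by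
  induction n generalizing y z with
  | zero =>
    refine ⟨1, ?_⟩
    have := y.2.1; have := y.2.2; have := z.2.1; have := z.2.2
    rw [pow_zero, abs_le]
    change -1 ≤ (y : ℝ) - z ∧ (y : ℝ) - z ≤ 1
    constructor <;> linarith
  | succ n ih =>
    have left : ∀ y z : unitInterval, 0 < y → y < 1 → (z : ℝ) ≤ 1 / 2 →
        ∃ f : F, |((f : HomeoPlus) y : ℝ) - z| ≤ (1 / 2) ^ (n + 1) := by
      intro y z h0 h1 hz
      -- A negative power of `shift` brings `y` into the left half. Rescaling to that half an
      -- element supplied by induction then halves the error.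
      obtain ⟨k, hk⟩ := exists_lt_shift_pow
        (show 0 < halve 1 by change (0 : ℝ) < ((1 : unitInterval) : ℝ) / 2; simp) h1
      set y' := ((shift ^ k : F) : HomeoPlus)⁻¹ y with hy'
      have hy1 : y' < halve 1 := (inv_lt_iff _).2 hk
      have hy0 : 0 < y' := by
        rw [hy', lt_inv_iff, apply_zero]; exact h0
      have hle : (y' : ℝ) ≤ 1 / 2 := by
        have h : (y' : ℝ) < ((1 : unitInterval) : ℝ) / 2 := hy1
        rw [Set.Icc.coe_one] at h
        exact h.le
      have hhd := halve_dbl hle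
      obtain ⟨f, hf⟩ := ih (dbl y') (dbl z)
        (by rw [← halve_lt_halve, hhd]
            have : halve 0 = 0 := by ext; simp [coe_halve]
            rwa [this])
        (by rwa [← halve_lt_halve, hhd])
      refine ⟨toLeft f * (shift ^ k)⁻¹, ?_⟩
      rw [Subgroup.coe_mul, mul_apply, Subgroup.coe_inv, ← hy', ← hhd, toLeft_halve,
        ← halve_dbl hz, coe_halve, coe_halve, ← sub_div, abs_div, abs_two, pow_succ]
      linarith
    rcases le_total (z : ℝ) (1 / 2) with hz | hz
    · exact left y z h0 h1 hz
    · obtain ⟨f, hf⟩ := left (unitInterval.symm y) (unitInterval.symm z)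
        (by rwa [unitInterval.lt_symm_comm, unitInterval.symm_zero])
        (by rwa [unitInterval.symm_lt_comm, unitInterval.symm_one])
        (by rw [unitInterval.coe_symm_eq]; linarith)
      refine ⟨flip f, ?_⟩
      rw [flip_apply, unitInterval.coe_symm_eq, abs_sub_comm]
      rw [unitInterval.coe_symm_eq] at hf
      convert hf using 2
      ring

theorem dense_orbit {y : unitInterval} (h0 : 0 < y) (h1 : y < 1) :
    Dense (Set.range fun f : F => (f : HomeoPlus) y) := by
  rw [Metric.dense_iff]
  intro z r hr
  obtain ⟨n, hn⟩ := exists_pow_lt_of_lt_one hr (show (1 / 2 : ℝ) < 1 by norm_num)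
  obtain ⟨f, hf⟩ := exists_abs_apply_sub_le n y z h0 h1
  exact ⟨_, show dist _ _ < r from hf.trans_lt hn, f, rfl⟩

/-! ### Proper quotients of Thompson's group. -/

section Normal

variable {N : Subgroup F} [N.Normal]

/-- By normality the fixed set of `N` is invariant under `F`, and it is closed. Containing one
interior point, it would contain a dense orbit, hence everything. -/
theorem exists_mem_apply_ne (hN : N ≠ ⊥) {y : unitInterval} (h0 : 0 < y) (h1 : y < 1) :
    ∃ g ∈ N, (g : HomeoPlus) y ≠ y := by
  by_contra! hc
  refine hN ((Subgroup.eq_bot_iff_forall N).2 fun g hg => F_ext fun z => ?_)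
  have hclosed : IsClosed {z | (g : HomeoPlus) z = z} :=
    isClosed_eq (continuous_coe _) continuous_id
  have hsub : (Set.range fun f : F => (f : HomeoPlus) y) ⊆ {z | (g : HomeoPlus) z = z} := by
    rintro _ ⟨f, rfl⟩
    have h2 := hc (f⁻¹ * g * f) (by
      have := ‹N.Normal›.conj_mem g hg f⁻¹
      rwa [inv_inv] at this)
    simp only [Subgroup.coe_mul, Subgroup.coe_inv, mul_apply, inv_apply_eq_iff] at h2
    exact h2
  have := hclosed.closure_subset_iff.2 hsub
  rw [(dense_orbit h0 h1).closure_eq] at this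
  exact this (Set.mem_univ z)

theorem exists_mem_lt_apply (hN : N ≠ ⊥) {p q : unitInterval} (hp : 0 < p) (hq : q < 1) :
    ∃ g ∈ N, q < (g : HomeoPlus) p := by
  obtain ⟨g, hg⟩ := exists_lt_apply_of_forall (thompson.subtype.comp N.subtype) (x := p) (y := q)
    fun z h1 h2 => by
      obtain ⟨g, hg, hgz⟩ := exists_mem_apply_ne hN (hp.trans_le h1) (h2.trans_lt hq)
      exact ⟨⟨g, hg⟩, hgz⟩
  exact ⟨g, g.2, hg⟩

theorem commute_mk_of_commutatorElement_mem {G : Type*} [Group G] {N : Subgroup G} [N.Normal]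
    {f g : G} : Commute (f : G ⧸ N) (g : G ⧸ N) ↔ ⁅f, g⁆ ∈ N := by
  rw [← QuotientGroup.eq_one_iff, ← commutatorElement_eq_one_iff_commute]
  rfl

/-- Some `g` in `N` pushes the support of `f₁` beyond that of `f₂`. The conjugate of `f₁` by `g`
commutes with `f₂` and has the same class as `f₁` modulo `N`. -/
theorem TrivialNearEnds.commute_mk (hN : N ≠ ⊥) {f₁ f₂ : F} (h₁ : TrivialNearEnds f₁)
    (h₂ : TrivialNearEnds f₂) : Commute (f₁ : F ⧸ N) (f₂ : F ⧸ N) := by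
  obtain ⟨p₁, q₁, hp₁, hq₁, hb₁⟩ := h₁.exists_bounds
  obtain ⟨p₂, q₂, hp₂, hq₂, hb₂⟩ := h₂.exists_bounds
  obtain ⟨g, hg, hlt⟩ := exists_mem_lt_apply hN (show 0 < p₁ from hp₁) (show q₂ < 1 from hq₂)
  have hcomm : Commute (g * f₁ * g⁻¹) f₂ := by
    refine F_commute_of_forall_fixed fun x => ?_
    simp only [Subgroup.coe_mul, Subgroup.coe_inv, mul_apply]
    by_contra! hc
    have h3 := ((hb₂ x).resolve_left hc.2).2
    have h4 := ((hb₁ ((g : HomeoPlus)⁻¹ x)).resolve_left fun h => hc.1 (by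
      rw [h, apply_inv_apply])).1
    rw [lt_inv_iff] at h4
    exact lt_asymm h3 (hlt.trans h4)
  have hmk : ((g * f₁ * g⁻¹ : F) : F ⧸ N) = f₁ := by
    have : (g : F ⧸ N) = 1 := (QuotientGroup.eq_one_iff g).2 hg
    rw [QuotientGroup.mk_mul, QuotientGroup.mk_mul, QuotientGroup.mk_inv, this]
    simp
  rw [← hmk]
  exact hcomm.map (QuotientGroup.mk' N)

/-- `shift`, rescaled to the left half of the interval. -/
noncomputable def leftShift : F := toLeft shift

theorem hasGerm_leftShift : HasGerm leftShift 1 := by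
  have h : (0 : unitInterval) < ⟨1 / 8, by norm_num, by norm_num⟩ := by
    change (0 : ℝ) < 1 / 8; norm_num
  filter_upwards [Iio_mem_nhds h] with x hx
  have hx' : (x : ℝ) < 1 / 8 := hx
  have hd := halve_dbl (x := x) (by linarith)
  rw [← hd, leftShift, toLeft_halve, coe_halve, coe_halve, shift_apply, shiftHomeo_of_le]
  · rw [zpow_one]; ring
  · rw [coe_dbl (by linarith)]; linarith

theorem hasGerm_flip_leftShift : HasGerm (flip leftShift) 0 := by
  refine hasGerm_zero_of_forall_lt
    (show 0 < halve 1 by change (0 : ℝ) < ((1 : unitInterval) : ℝ) / 2; simp) fun x hx => ?_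
  have hx' : (x : ℝ) < ((1 : unitInterval) : ℝ) / 2 := hx
  rw [Set.Icc.coe_one] at hx'
  have h := toRight_of_le (flip shift) hx'.le
  rwa [toRight_apply, flip_flip] at h

theorem exists_hasGerm_one_fixing {p : unitInterval} (hp : 0 < p) :
    ∃ l : F, HasGerm l 1 ∧ HasGerm (flip l) 0 ∧ ∀ x, p ≤ x → (l : HomeoPlus) x = x := by
  obtain ⟨k, hk⟩ := exists_lt_shift_pow hp
    (show halve 1 < 1 by change ((1 : unitInterval) : ℝ) / 2 < ((1 : unitInterval) : ℝ); norm_num)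
  obtain ⟨m, hm⟩ := exists_hasGerm (shift ^ k)
  obtain ⟨n, hn⟩ := exists_hasGerm (flip (shift ^ k))
  refine ⟨(shift ^ k)⁻¹ * leftShift * shift ^ k, ?_, ?_, fun x hx => ?_⟩
  · have := (hm.inv.mul hasGerm_leftShift).mul hm
    rwa [show -m + 1 + m = 1 by ring] at this
  · have := (hn.inv.mul hasGerm_flip_leftShift).mul hn
    rw [show -n + 0 + n = 0 by ring] at this
    rwa [map_mul, map_mul, map_inv]
  · simp only [Subgroup.coe_mul, Subgroup.coe_inv, mul_apply]
    rw [inv_apply_eq_iff]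
    refine toLeft_of_ge _ ?_
    have h1 : halve 1 ≤ ((shift ^ k : F) : HomeoPlus) x := hk.le.trans ((le_iff_le _).2 hx)
    have h2 : ((1 : unitInterval) : ℝ) / 2 ≤ (((shift ^ k : F) : HomeoPlus) x : unitInterval) := h1
    simpa using h2

/-- The germs of `f` at the two ends are recorded by a pair of integers, and `l`, `r` realise the
two basis vectors, so suitable powers cancel both germs. -/
theorem exists_trivialNearEnds_mul (f : F) {l r : F} (hl : HasGerm l 1) (hl' : HasGerm (flip l) 0)
    (hr : HasGerm r 0) (hr' : HasGerm (flip r) 1) :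
    ∃ m n : ℤ, TrivialNearEnds (f * (l ^ m * r ^ n)) := by
  obtain ⟨m, hm⟩ := exists_hasGerm f
  obtain ⟨n, hn⟩ := exists_hasGerm (flip f)
  refine ⟨-m, -n, ?_, ?_⟩
  · have := hm.mul ((hl.zpow (-m)).mul (hr.zpow (-n)))
    rwa [show m + (-m * 1 + -n * 0) = 0 by ring] at this
  · have := hn.mul ((hl'.zpow (-m)).mul (hr'.zpow (-n)))
    rw [show n + (-m * 0 + -n * 1) = 0 by ring] at this
    rwa [map_mul, map_mul, map_zpow, map_zpow]

/-- The germs of `f` can be cancelled by elements supported so close to the ends that they commute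
with `u` already in `F`. What remains of `f` is trivial near the ends and commutes with `u` modulo
`N`. -/
theorem TrivialNearEnds.commute_mk_right (hN : N ≠ ⊥) (f : F) {u : F} (hu : TrivialNearEnds u) :
    Commute (f : F ⧸ N) (u : F ⧸ N) := by
  obtain ⟨p, q, hp, hq, hb⟩ := hu.exists_bounds
  obtain ⟨l, hl, hl', hlfix⟩ := exists_hasGerm_one_fixing hp
  obtain ⟨r, hr, hr', hrfix⟩ := exists_hasGerm_one_fixing (p := unitInterval.symm q)
    (by rwa [unitInterval.lt_symm_comm, unitInterval.symm_zero])
  obtain ⟨m, n, hmn⟩ := exists_trivialNearEnds_mul f (r := flip r) hl hl' hr'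
    (by rwa [flip_flip])
  have hcl : Commute l u := F_commute_of_forall_fixed fun x =>
    (hb x).symm.imp (fun h => hlfix x h.1.le) id
  have hcr : Commute (flip r) u := F_commute_of_forall_fixed fun x =>
    (hb x).symm.imp (fun h => by
      rw [flip_apply, hrfix _ (unitInterval.symm_le_symm.2 h.2.le), unitInterval.symm_symm]) id
  have hk : Commute (l ^ m * (flip r) ^ n) u := (hcl.zpow_left m).mul_left (hcr.zpow_left n)
  have h1 := hmn.commute_mk hN hu
  have h2 := hk.map (QuotientGroup.mk' N)
  have h3 := h1.mul_left h2.inv_left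
  rwa [← map_inv, QuotientGroup.mk'_apply, ← QuotientGroup.mk_mul, mul_assoc, mul_inv_cancel,
    mul_one] at h3

/-- Every proper quotient of Thompson's group `F` is abelian. -/
theorem commutator_le_of_normal (hN : N ≠ ⊥) : ⁅(⊤ : Subgroup F), (⊤ : Subgroup F)⁆ ≤ N := by
  rw [Subgroup.commutator_le]
  intro f _ g _
  rw [← commute_mk_of_commutatorElement_mem]
  have hlr : Commute leftShift (flip leftShift) := by
    have h := commute_toLeft_toRight shift (flip shift)
    change Commute leftShift (flip (toLeft (flip (flip shift)))) at h
    rwa [flip_flip] at h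
  -- Modulo `N` the factor `c` is central, and the remaining factors are powers of two fixed
  -- commuting elements; hence all classes commute.
  have key : ∀ f : F, ∃ (c : F) (m n : ℤ), TrivialNearEnds c ∧
      f = c * (leftShift ^ m * (flip leftShift) ^ n) := by
    intro f
    obtain ⟨m, n, h⟩ := exists_trivialNearEnds_mul f (r := flip leftShift) hasGerm_leftShift
      hasGerm_flip_leftShift hasGerm_flip_leftShift (by rw [flip_flip]; exact hasGerm_leftShift)
    refine ⟨_, -m, -n, h, ?_⟩
    rw [(hlr.zpow_zpow (-m) (-n)).eq, zpow_neg, zpow_neg, mul_assoc f, ← mul_inv_rev,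
      mul_inv_cancel, mul_one]
  obtain ⟨c, m, n, hc, rfl⟩ := key f
  obtain ⟨c', m', n', hc', rfl⟩ := key g
  have h1 : Commute (leftShift ^ m * (flip leftShift) ^ n)
      (leftShift ^ m' * (flip leftShift) ^ n') :=
    Commute.mul_left
      (Commute.mul_right (Commute.zpow_zpow_self _ _ _) (hlr.zpow_zpow _ _))
      (Commute.mul_right (hlr.symm.zpow_zpow _ _) (Commute.zpow_zpow_self _ _ _))
  have h2 : Commute ((leftShift ^ m * (flip leftShift) ^ n : F) : F ⧸ N)
      (((c' : F) : F ⧸ N) * ((leftShift ^ m' * (flip leftShift) ^ n' : F) : F ⧸ N)) :=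
    Commute.mul_right (hc'.commute_mk_right hN _) (h1.map (QuotientGroup.mk' N))
  exact Commute.mul_left (hc.commute_mk_right hN _).symm h2

end Normal

theorem commutator_shift_leftShift_ne_one : ⁅shift, leftShift⁆ ≠ 1 := by
  rw [Ne, commutatorElement_eq_one_iff_mul_comm]
  intro h
  have h1 : ((shift * leftShift : F) : HomeoPlus) (halve (halve 1)) =
    ((leftShift * shift : F) : HomeoPlus) (halve (halve 1)) := by rw [h]
  simp only [Subgroup.coe_mul, mul_apply] at h1
  have h2 : (shift : HomeoPlus) (halve (halve 1)) = halve 1 := by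
    ext
    rw [shift_apply, shiftHomeo_of_le] <;> simp only [coe_halve, Set.Icc.coe_one] <;> norm_num
  have h3 : (leftShift : HomeoPlus) (halve 1) = halve 1 :=
    toLeft_of_ge _ (by simp [coe_halve])
  rw [h2, h3, ← h2, ((shift : HomeoPlus)).injective.eq_iff, leftShift, toLeft_halve] at h1
  have h4 := congrArg dbl h1
  rw [dbl_halve, dbl_halve, h2] at h4
  refine (lt_shiftHomeo (x := halve 1) ?_ ?_).ne' h4
  · change (0 : ℝ) < ((1 : unitInterval) : ℝ) / 2; simp
  · change ((1 : unitInterval) : ℝ) / 2 < ((1 : unitInterval) : ℝ); norm_num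

/-- In the standard action of `F`, some interval in the interior has two disjoint images inside
itself. -/
theorem exists_crossing : ∃ (f₁ f₂ : F) (p q : unitInterval), p < q ∧
    p < (f₁ : HomeoPlus) p ∧
    (f₁ : HomeoPlus) q < (f₂ : HomeoPlus) p ∧ (f₂ : HomeoPlus) q < q := by
  -- On the open interval `c` attracts every point towards 1/2; its conjugate `d` attracts towards
  -- `shift (1/2) = 3/4`.
  set c : F := toLeft shift * (toRight shift)⁻¹ with hc
  have hdbl : ∀ x : unitInterval, 0 < (x : ℝ) → (x : ℝ) < 1 / 2 →
      x < (toLeft shift : HomeoPlus) x := by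
    intro x h0 h1
    rw [← halve_dbl h1.le, toLeft_halve, halve_lt_halve]
    refine lt_shiftHomeo ?_ ?_
    · change (0 : ℝ) < dbl x
      rw [coe_dbl h1.le]; linarith
    · change (dbl x : ℝ) < ((1 : unitInterval) : ℝ)
      rw [coe_dbl h1.le, Set.Icc.coe_one]; linarith
  have hdbl' : ∀ x : unitInterval, 1 / 2 < (x : ℝ) → (x : ℝ) < 1 →
      x < (toRight shift : HomeoPlus) x := by
    intro x h0 h1
    have hx : ((unitInterval.symm x : unitInterval) : ℝ) ≤ 1 / 2 := by
      rw [unitInterval.coe_symm_eq]; linarith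
    rw [toRight_apply, unitInterval.lt_symm_comm, ← halve_dbl hx, toLeft_halve, halve_lt_halve,
      flip_apply, unitInterval.symm_lt_comm]
    refine lt_shiftHomeo ?_ ?_
    · rw [unitInterval.lt_symm_comm, unitInterval.symm_zero]
      change (dbl (unitInterval.symm x) : ℝ) < ((1 : unitInterval) : ℝ)
      rw [coe_dbl hx, Set.Icc.coe_one, unitInterval.coe_symm_eq]; linarith
    · rw [unitInterval.symm_lt_comm, unitInterval.symm_one]
      change (0 : ℝ) < dbl (unitInterval.symm x)
      rw [coe_dbl hx, unitInterval.coe_symm_eq]; linarith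
  have hlow : ∀ x : unitInterval, 0 < (x : ℝ) → (x : ℝ) < 1 / 2 → x < (c : HomeoPlus) x := by
    intro x h0 h1
    have h2 : (toRight shift : HomeoPlus)⁻¹ x = x :=
      (inv_apply_eq_self_iff _).2 (toRight_of_le _ h1.le)
    rw [hc, Subgroup.coe_mul, mul_apply, Subgroup.coe_inv, h2]
    exact hdbl x h0 h1
  have hhigh : ∀ x : unitInterval, 1 / 2 < (x : ℝ) → (x : ℝ) < 1 → (c : HomeoPlus) x < x := by
    intro x h0 h1
    rw [hc, (commute_toLeft_toRight shift shift).inv_right.eq, Subgroup.coe_mul, mul_apply,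
      Subgroup.coe_inv, inv_lt_iff, toLeft_of_ge _ h0.le]
    exact hdbl' x h0 h1
  set d : F := shift * c * shift⁻¹ with hd
  have hs : (shiftHomeo (halve 1) : ℝ) = 3 / 4 := by
    rw [shiftHomeo_of_ge] <;> simp only [coe_halve, Set.Icc.coe_one] <;> norm_num
  have hdapp : ∀ x, (d : HomeoPlus) x = shiftHomeo ((c : HomeoPlus) (shiftHomeo⁻¹ x)) :=
    fun _ => rfl
  have hdlow : ∀ x : unitInterval, 0 < (x : ℝ) → (x : ℝ) < 3 / 4 → x < (d : HomeoPlus) x := by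
    intro x h0 h1
    rw [hdapp, ← inv_lt_iff]
    refine hlow _ ?_ ?_
    · change 0 < shiftHomeo⁻¹ x
      rw [lt_inv_iff, apply_zero]; exact h0
    · have : shiftHomeo⁻¹ x < halve 1 := by
        rw [inv_lt_iff]
        change (x : ℝ) < shiftHomeo (halve 1)
        rw [hs]; exact h1
      have h2 : (shiftHomeo⁻¹ x : ℝ) < ((1 : unitInterval) : ℝ) / 2 := this
      rwa [Set.Icc.coe_one] at h2
  have hdhigh : ∀ x : unitInterval, 3 / 4 < (x : ℝ) → (x : ℝ) < 1 → (d : HomeoPlus) x < x := by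
    intro x h0 h1
    rw [hdapp, ← lt_inv_iff]
    refine hhigh _ ?_ ?_
    · have : halve 1 < shiftHomeo⁻¹ x := by
        rw [lt_inv_iff]
        change (shiftHomeo (halve 1) : ℝ) < x
        rw [hs]; exact h0
      have h2 : ((1 : unitInterval) : ℝ) / 2 < (shiftHomeo⁻¹ x : ℝ) := this
      rwa [Set.Icc.coe_one] at h2
    · have : shiftHomeo⁻¹ x < 1 := by rw [inv_lt_iff, apply_one]; exact h1
      exact this
  -- The interval `[p, q]` contains both attracting points in its interior and `t` separates them.
  -- High powers of `c` and `d` therefore contract `[p, q]` to opposite sides of `t`.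
  set p : unitInterval := ⟨1 / 4, by norm_num, by norm_num⟩ with hp
  set t : unitInterval := ⟨5 / 8, by norm_num, by norm_num⟩ with ht
  set q : unitInterval := ⟨7 / 8, by norm_num, by norm_num⟩ with hq
  have hpt : p < t := by change (1 / 4 : ℝ) < 5 / 8; norm_num
  have htq : t < q := by change (5 / 8 : ℝ) < 7 / 8; norm_num
  obtain ⟨n, hn⟩ := exists_pow_apply_lt (c : HomeoPlus) (x := q) (y := t) fun z h1 h2 => by
    have h1' : (5 / 8 : ℝ) ≤ z := h1
    have h2' : (z : ℝ) ≤ 7 / 8 := h2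
    exact hhigh z (by linarith) (by linarith)
  obtain ⟨m, hm⟩ := exists_lt_pow_apply (d : HomeoPlus) (x := p) (y := t) fun z h1 h2 => by
    have h1' : (1 / 4 : ℝ) ≤ z := h1
    have h2' : (z : ℝ) ≤ 5 / 8 := h2
    exact hdlow z (by linarith) (by linarith)
  have hn0 : n ≠ 0 := by rintro rfl; exact lt_asymm hn htq
  have hm0 : m ≠ 0 := by rintro rfl; exact lt_asymm hm hpt
  refine ⟨c ^ n, d ^ m, p, q, hpt.trans htq, ?_, ?_, ?_⟩
  · exact lt_pow_apply (c : HomeoPlus) (hlow p (by norm_num [hp]) (by norm_num [hp])) hn0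
  · exact lt_trans hn hm
  · have h1 : q < (d : HomeoPlus)⁻¹ q :=
      (lt_inv_iff _).2 (hdhigh q (by norm_num [hq]) (by norm_num [hq]))
    have h2 := lt_pow_apply _ h1 hm0
    rwa [inv_pow, lt_inv_iff] at h2


/-! ### Commuting actions with overlapping supports -/

theorem connectedComponentIn_eq_Ioo {S : Set unitInterval} (hS : IsOpen S) (h0 : 0 ∉ S)
    (h1 : 1 ∉ S) {x : unitInterval} (hx : x ∈ S) :
    ∃ u v, u < x ∧ x < v ∧ u ∉ S ∧ v ∉ S ∧ Set.Ioo u v ⊆ S ∧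
      connectedComponentIn S x = Set.Ioo u v := by
  obtain ⟨u, ⟨hu, hux⟩, hmax⟩ := (hS.isClosed_compl.inter isClosed_Iic).isCompact.exists_isGreatest
    (⟨0, h0, x.2.1⟩ : (Sᶜ ∩ Set.Iic x).Nonempty)
  obtain ⟨v, ⟨hv, hvx⟩, hmin⟩ := (hS.isClosed_compl.inter isClosed_Ici).isCompact.exists_isLeast
    (⟨1, h1, x.2.2⟩ : (Sᶜ ∩ Set.Ici x).Nonempty)
  have hux' : u < x := lt_of_le_of_ne hux fun h => hu (h ▸ hx)
  have hvx' : x < v := lt_of_le_of_ne hvx fun h => hv (h ▸ hx)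
  have hsub : Set.Ioo u v ⊆ S := by
    intro y hy
    by_contra hyS
    rcases le_total y x with h | h
    · exact absurd (hmax ⟨hyS, h⟩) (not_le.2 hy.1)
    · exact absurd (hmin ⟨hyS, h⟩) (not_le.2 hy.2)
  refine ⟨u, v, hux', hvx', hu, hv, hsub, Set.Subset.antisymm ?_ ?_⟩
  · intro y hy
    have hord := (isPreconnected_connectedComponentIn (F := S) (x := x)).ordConnected
    have hxm := mem_connectedComponentIn hx
    have hcs := connectedComponentIn_subset S x
    constructor
    · by_contra! h
      exact hu (hcs (hord.out hy hxm ⟨h, hux⟩))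
    · by_contra! h
      exact hv (hcs (hord.out hxm hy ⟨hvx, h⟩))
  · exact isPreconnected_Ioo.subset_connectedComponentIn ⟨hux', hvx'⟩ hsub

section Supp

variable {G : Type*} [Group G] (ψ : G →* diffPlus)

theorem isOpen_supp (H : Subgroup G) : IsOpen (supp ψ H) := by
  have : supp ψ H = ⋃ g ∈ H, {x | (ψ g : HomeoPlus) x ≠ x} := by
    ext x
    simp [supp]
  rw [this]
  exact isOpen_biUnion fun g _ => isOpen_ne_fun (continuous_coe _) continuous_id

theorem zero_notMem_supp (H : Subgroup G) : 0 ∉ supp ψ H := fun ⟨_, _, h⟩ => h (apply_zero _)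

theorem one_notMem_supp (H : Subgroup G) : 1 ∉ supp ψ H := fun ⟨_, _, h⟩ => h (apply_one _)

theorem notMem_supp_iff {H : Subgroup G} {x : unitInterval} :
    x ∉ supp ψ H ↔ ∀ g ∈ H, (ψ g : HomeoPlus) x = x := by
  simp [supp]

theorem supp_comp {G' : Type*} [Group G'] (ι : G' →* G) (H : Subgroup G') :
    supp (ψ.comp ι) H = supp ψ (H.map ι) := by
  ext x
  simp [supp]

end Supp

theorem apply_eq_of_isLeast {f : HomeoPlus} {K : Set unitInterval} {m : unitInterval}
    (hm : IsLeast K m) (h : ∀ y ∈ K, f y ∈ K) (h' : ∀ y ∈ K, f⁻¹ y ∈ K) : f m = m :=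
  le_antisymm ((le_inv_iff f).1 (hm.2 (h' m hm.1))) (hm.2 (h m hm.1))

theorem apply_eq_of_isGreatest {f : HomeoPlus} {K : Set unitInterval} {m : unitInterval}
    (hm : IsGreatest K m) (h : ∀ y ∈ K, f y ∈ K) (h' : ∀ y ∈ K, f⁻¹ y ∈ K) : f m = m :=
  le_antisymm (hm.2 (h m hm.1)) ((inv_le_iff f).1 (hm.2 (h' m hm.1)))

theorem leftShift_apply_halve_one : (leftShift : HomeoPlus) (halve 1) = halve 1 :=
  toLeft_of_ge _ (by simp [coe_halve])

theorem le_of_leftShift_apply_eq {y : unitInterval} (h0 : y ≠ 0)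
    (h : (leftShift : HomeoPlus) y = y) : halve 1 ≤ y := by
  rcases eq_halve_or_ge y with ⟨z, rfl⟩ | hy
  · rw [leftShift, toLeft_halve] at h
    have h1 := congrArg dbl h
    rw [dbl_halve, dbl_halve] at h1
    rw [halve_le_halve]
    by_contra! hz
    refine (lt_shiftHomeo (bot_lt_iff_ne_bot.2 fun hz0 => h0 ?_) hz).ne' h1
    rw [hz0]
    ext
    exact zero_div 2
  · change ((1 : unitInterval) : ℝ) / 2 ≤ y
    simpa using hy

/-! ### Actions monotonically semi-conjugate to the standard action, up to an automorphism `θ`. -/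

section Monotone

variable {ρ : F →* diffPlus} {u v : unitInterval} {θ : F →* F} {h : unitInterval → unitInterval}

theorem apply_mem_Icc (hu : ∀ g, (ρ g : HomeoPlus) u = u) (hv : ∀ g, (ρ g : HomeoPlus) v = v)
    (g : F) {y : unitInterval} (hy : y ∈ Set.Icc u v) : (ρ g : HomeoPlus) y ∈ Set.Icc u v := by
  constructor
  · rw [← hu g, le_iff_le]; exact hy.1
  · rw [← hv g, le_iff_le]; exact hy.2

/-- Any homeomorphism preserving `u`, `v` and commuting with `l` must fix `m`. Take `l` acting below
as `leftShift`, which fixes 1/2 and moves every point of `(0, 1/2)`; then `m` is the least point of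
the compact fibre of `h` over 1/2. -/
theorem exists_isLeast_fixed_of_monotone (huv : u < v)
    (hu : ∀ g, (ρ g : HomeoPlus) u = u) (hv : ∀ g, (ρ g : HomeoPlus) v = v)
    (hmove : ∀ y, u < y → y < v → ∃ g, (ρ g : HomeoPlus) y ≠ y)
    (hθ : Function.Surjective θ) (hcont : ContinuousOn h (Set.Icc u v))
    (hmono : MonotoneOn h (Set.Icc u v)) (hsurj : h '' Set.Icc u v = Set.univ)
    (heq : ∀ g, ∀ y ∈ Set.Icc u v, h ((ρ g : HomeoPlus) y) = (θ g : HomeoPlus) (h y)) :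
    ∃ (l : F) (m : unitInterval),
      IsLeast {y | u < y ∧ y < v ∧ (ρ l : HomeoPlus) y = y} m := by
  have hpre : ∀ t, ∃ y ∈ Set.Icc u v, h y = t := fun t => by
    have := Set.mem_univ t
    rwa [← hsurj] at this
  have hhu : h u = 0 := by
    obtain ⟨y, hy, hy0⟩ := hpre 0
    exact le_antisymm (hy0 ▸ hmono ⟨le_rfl, huv.le⟩ hy hy.1) bot_le
  have hhv : h v = 1 := by
    obtain ⟨y, hy, hy0⟩ := hpre 1
    exact le_antisymm le_top (hy0 ▸ hmono hy ⟨huv.le, le_rfl⟩ hy.2)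
  have hinv : ∀ g y, (ρ g : HomeoPlus)⁻¹ y = (ρ g⁻¹ : HomeoPlus) y := by
    intro g y
    rw [map_inv]; rfl
  have hcompact : ∀ t, IsCompact (Set.Icc u v ∩ h ⁻¹' {t}) := fun t =>
    (hcont.preimage_isClosed_of_isClosed isClosed_Icc isClosed_singleton).isCompact
  have hne : ∀ t, (Set.Icc u v ∩ h ⁻¹' {t}).Nonempty := fun t => by
    obtain ⟨y, hy, hyt⟩ := hpre t
    exact ⟨y, hy, hyt⟩
  have hstable : ∀ t g, (θ g : HomeoPlus) t = t → ∀ y ∈ Set.Icc u v ∩ h ⁻¹' {t},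
      (ρ g : HomeoPlus) y ∈ Set.Icc u v ∩ h ⁻¹' {t} := by
    intro t g ht y hy
    refine ⟨apply_mem_Icc hu hv g hy.1, ?_⟩
    change h _ = t
    rw [heq g y hy.1, show h y = t from hy.2, ht]
  have hstable' : ∀ t g, (θ g : HomeoPlus) t = t → ∀ y ∈ Set.Icc u v ∩ h ⁻¹' {t},
      (ρ g : HomeoPlus)⁻¹ y ∈ Set.Icc u v ∩ h ⁻¹' {t} := by
    intro t g ht y hy
    rw [hinv]
    refine hstable t g⁻¹ ?_ y hy
    rw [map_inv]
    exact (inv_apply_eq_self_iff _).2 ht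
  -- The fibre over 0 is invariant under the whole action, so its greatest point is a global fixed
  -- point. Such a point cannot lie in `(u, v)`.
  have hpos : ∀ y, u < y → y < v → h y ≠ 0 := by
    intro y huy hyv hy0
    obtain ⟨z, hz⟩ := (hcompact 0).exists_isGreatest (hne 0)
    have hyz : y ≤ z := hz.2 ⟨⟨huy.le, hyv.le⟩, hy0⟩
    have hzv : z < v := lt_of_le_of_ne hz.1.1.2 fun hzv => by
      have h1 : h z = 0 := hz.1.2
      rw [hzv, hhv] at h1
      exact one_ne_zero h1
    obtain ⟨g, hg⟩ := hmove z (huy.trans_le hyz) hzv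
    exact hg (apply_eq_of_isGreatest hz (hstable 0 g (apply_zero _)) (hstable' 0 g (apply_zero _)))
  obtain ⟨l, hl⟩ := hθ leftShift
  obtain ⟨m, hm⟩ := (hcompact (halve 1)).exists_isLeast (hne (halve 1))
  have hlfix : (θ l : HomeoPlus) (halve 1) = halve 1 := by rw [hl, leftShift_apply_halve_one]
  have hhm : h m = halve 1 := hm.1.2
  have hhm' : (h m : ℝ) = 1 / 2 := by rw [hhm, coe_halve, Set.Icc.coe_one]
  refine ⟨l, m, ⟨?_, ?_, ?_⟩, ?_⟩
  · refine lt_of_le_of_ne hm.1.1.1 fun hum => ?_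
    rw [← hum, hhu] at hhm'
    norm_num at hhm'
  · refine lt_of_le_of_ne hm.1.1.2 fun hmv => ?_
    rw [hmv, hhv] at hhm'
    norm_num at hhm'
  · exact apply_eq_of_isLeast hm (hstable _ l hlfix) (hstable' _ l hlfix)
  · rintro y ⟨huy, hyv, hy⟩
    have hyI : y ∈ Set.Icc u v := ⟨huy.le, hyv.le⟩
    have h1 := heq l y hyI
    rw [hy, hl] at h1
    have h2 := le_of_leftShift_apply_eq (hpos y huy hyv) h1.symm
    by_contra! hlt
    have h3 := hmono hyI hm.1.1 hlt.le
    rw [hhm] at h3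
    exact absurd (hm.2 ⟨hyI, le_antisymm h3 h2⟩) (not_le.2 hlt)

/-- Strict inequalities between values of a monotone `h` lift to the points, so the crossing of the
standard action pulls back. -/
theorem exists_crossing_of_monotone
    (hu : ∀ g, (ρ g : HomeoPlus) u = u) (hv : ∀ g, (ρ g : HomeoPlus) v = v)
    (hθ : Function.Surjective θ)
    (hmono : MonotoneOn h (Set.Icc u v)) (hsurj : h '' Set.Icc u v = Set.univ)
    (heq : ∀ g, ∀ y ∈ Set.Icc u v, h ((ρ g : HomeoPlus) y) = (θ g : HomeoPlus) (h y)) :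
    ∃ (f₁ f₂ : F) (a b : unitInterval), u ≤ a ∧ a ≤ b ∧ b ≤ v ∧ a < (ρ f₁ : HomeoPlus) a ∧
      (ρ f₁ : HomeoPlus) b < (ρ f₂ : HomeoPlus) a ∧ (ρ f₂ : HomeoPlus) b < b := by
  have hpre : ∀ t, ∃ y ∈ Set.Icc u v, h y = t := fun t => by
    have := Set.mem_univ t
    rwa [← hsurj] at this
  have hlt : ∀ {y z}, y ∈ Set.Icc u v → z ∈ Set.Icc u v → h y < h z → y < z := by
    intro y z hy hz hyz
    by_contra! hle
    exact absurd (hmono hz hy hle) (not_le.2 hyz)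
  obtain ⟨k₁, k₂, p, q, hpq, h1, h2, h3⟩ := exists_crossing
  obtain ⟨f₁, rfl⟩ := hθ k₁
  obtain ⟨f₂, rfl⟩ := hθ k₂
  obtain ⟨a, ha, rfl⟩ := hpre p
  obtain ⟨b, hb, rfl⟩ := hpre q
  refine ⟨f₁, f₂, a, b, ha.1, (hlt ha hb hpq).le, hb.2, ?_, ?_, ?_⟩
  · refine hlt ha (apply_mem_Icc hu hv _ ha) ?_
    rwa [heq _ _ ha]
  · refine hlt (apply_mem_Icc hu hv _ hb) (apply_mem_Icc hu hv _ ha) ?_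
    rwa [heq _ _ ha, heq _ _ hb]
  · refine hlt (apply_mem_Icc hu hv _ hb) hb ?_
    rwa [heq _ _ hb]

/-- A homeomorphism commuting with an action semi-conjugate to the standard one on `[u, v]` fixes
`u`, `v` and a point between them. -/
theorem exists_fixed_of_commute_of_monotone (huv : u < v)
    (hu : ∀ g, (ρ g : HomeoPlus) u = u) (hv : ∀ g, (ρ g : HomeoPlus) v = v)
    (hmove : ∀ y, u < y → y < v → ∃ g, (ρ g : HomeoPlus) y ≠ y)
    (hθ : Function.Surjective θ) (hcont : ContinuousOn h (Set.Icc u v))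
    (hmono : MonotoneOn h (Set.Icc u v)) (hsurj : h '' Set.Icc u v = Set.univ)
    (heq : ∀ g, ∀ y ∈ Set.Icc u v, h ((ρ g : HomeoPlus) y) = (θ g : HomeoPlus) (h y)) :
    ∃ m, u < m ∧ m < v ∧ ∀ k : HomeoPlus, (∀ g, Commute k (ρ g : HomeoPlus)) →
      k u = u ∧ k v = v ∧ k m = m := by
  obtain ⟨l, m, hm⟩ := exists_isLeast_fixed_of_monotone huv hu hv hmove hθ hcont hmono hsurj heq
  obtain ⟨f₁, f₂, a, b, hua, hab, hbv, h1, h2, h3⟩ :=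
    exists_crossing_of_monotone hu hv hθ hmono hsurj heq
  have hesc : ∀ k : HomeoPlus, (∀ g, Commute k (ρ g : HomeoPlus)) → u < k v := by
    intro k hk
    by_contra! hle
    exact IsC1.false_of_crossing (ρ f₁).2.1 (ρ f₂).2.1 huv (hu f₁) (hu f₂) hua hab hbv h1 h2 h3
      (hk f₁) (hk f₂) hle
  have hfix : ∀ k : HomeoPlus, (∀ g, Commute k (ρ g : HomeoPlus)) → ∀ (y : unitInterval) (g : F),
      (ρ g : HomeoPlus) y = y → (ρ g : HomeoPlus) (k y) = k y := by
    intro k hk y g hy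
    rw [← mul_apply, ← (hk g).eq, mul_apply, hy]
  -- Being in the centralizer, `k` and its inverse permute the global fixed points, none of which
  -- lies in `(u, v)`. As `u < k v`, an endpoint moving left would place such a point inside.
  have hle : ∀ k : HomeoPlus, (∀ g, Commute k (ρ g : HomeoPlus)) → u ≤ k u ∧ v ≤ k v := by
    intro k hk
    have hk' : ∀ g, Commute k⁻¹ (ρ g : HomeoPlus) := fun g => (hk g).inv_left
    constructor
    · by_contra! hlt
      obtain ⟨g, hg⟩ := hmove (k⁻¹ u) ((lt_inv_iff k).2 hlt)
        ((inv_lt_iff k).2 (hesc k hk))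
      exact hg (hfix _ hk' u g (hu g))
    · by_contra! hlt
      obtain ⟨g, hg⟩ := hmove (k v) (hesc k hk) hlt
      exact hg (hfix _ hk v g (hv g))
  have hend : ∀ k : HomeoPlus, (∀ g, Commute k (ρ g : HomeoPlus)) → k u = u ∧ k v = v := by
    intro k hk
    have h1 := hle k hk
    have h2 := hle k⁻¹ fun g => (hk g).inv_left
    rw [le_inv_iff, le_inv_iff] at h2
    exact ⟨le_antisymm h2.1 h1.1, le_antisymm h2.2 h1.2⟩
  have hstable : ∀ k : HomeoPlus, (∀ g, Commute k (ρ g : HomeoPlus)) →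
      ∀ y ∈ {y | u < y ∧ y < v ∧ (ρ l : HomeoPlus) y = y},
        k y ∈ {y | u < y ∧ y < v ∧ (ρ l : HomeoPlus) y = y} := by
    rintro k hk y ⟨hy1, hy2, hy3⟩
    obtain ⟨e1, e2⟩ := hend k hk
    refine ⟨?_, ?_, hfix k hk y l hy3⟩
    · rw [← e1, lt_iff_lt]; exact hy1
    · rw [← e2, lt_iff_lt]; exact hy2
  refine ⟨m, hm.1.1, hm.1.2.1, fun k hk => ⟨(hend k hk).1, (hend k hk).2, ?_⟩⟩
  exact apply_eq_of_isLeast hm (hstable k hk) (hstable k⁻¹ fun g => (hk g).inv_left)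

end Monotone

theorem exists_fixed_of_commute_of_semiconj {ρ : F →* diffPlus} {u v : unitInterval} (huv : u < v)
    (hu : ∀ g, (ρ g : HomeoPlus) u = u) (hv : ∀ g, (ρ g : HomeoPlus) v = v)
    (hmove : ∀ y, u < y → y < v → ∃ g, (ρ g : HomeoPlus) y ≠ y)
    (hsemi : SemiconjStandardOn ρ (Set.Ioo u v)) :
    ∃ m, u < m ∧ m < v ∧ ∀ k : HomeoPlus, (∀ g, Commute k (ρ g : HomeoPlus)) →
      k u = u ∧ k v = v ∧ k m = m := by
  obtain ⟨h, hcont, hmono, hsurj, heq⟩ := hsemi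
  rw [closure_Ioo huv.ne] at hcont hmono hsurj heq
  rcases hmono with hmono | hanti
  · exact exists_fixed_of_commute_of_monotone (θ := MonoidHom.id F) huv hu hv hmove
      Function.surjective_id hcont hmono hsurj heq
  -- An order-reversing semi-conjugacy becomes order preserving after reflecting its target, at the
  -- cost of twisting the standard action by `flip`.
  · refine exists_fixed_of_commute_of_monotone (θ := flip) (h := fun y => unitInterval.symm (h y))
      huv hu hv hmove (show Function.Involutive flip from flip_flip).surjective
      (unitInterval.continuous_symm.comp_continuousOn hcont)
      (fun y hy z hz hyz => unitInterval.symm_le_symm.2 (hanti hy hz hyz)) ?_ ?_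
    · refine Set.eq_univ_of_forall fun t => ?_
      have := Set.mem_univ (unitInterval.symm t)
      rw [← hsurj] at this
      obtain ⟨y, hy, hyt⟩ := this
      exact ⟨y, hy, by simp only [hyt, unitInterval.symm_symm]⟩
    · intro g y hy
      rw [heq g y hy, flip_apply, unitInterval.symm_symm]

/-- An action of `F` on an invariant interval is faithful as soon as it is not abelian. -/
theorem faithfulOn_of_commutator {ρ : F →* diffPlus} {J : Set unitInterval}
    (hJ : ∀ g, ∀ y ∈ J, (ρ g : HomeoPlus) y ∈ J) {x : unitInterval} (hxJ : x ∈ J)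
    (hx : x ∈ supp ρ ⁅(⊤ : Subgroup F), (⊤ : Subgroup F)⁆) : FaithfulOn ρ J := by
  let N : Subgroup F :=
    { carrier := {g | ∀ y ∈ J, (ρ g : HomeoPlus) y = y}
      one_mem' := fun y _ => by rw [map_one]; rfl
      mul_mem' := fun {f g} hf hg y hy => by
        rw [map_mul, Subgroup.coe_mul, mul_apply, hg y hy, hf y hy]
      inv_mem' := fun {f} hf y hy => by
        rw [map_inv, Subgroup.coe_inv, inv_apply_eq_self_iff]
        exact hf y hy }
  have hN : N.Normal := ⟨fun n hn g y hy => by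
    have h1 := hn _ (hJ g⁻¹ y hy)
    rw [map_mul, map_mul, Subgroup.coe_mul, Subgroup.coe_mul, mul_apply, mul_apply, h1, map_inv,
      Subgroup.coe_inv, apply_inv_apply]⟩
  -- A nontrivial kernel would contain the commutator subgroup, but some commutator element moves
  -- `x`.
  have hbot : N = ⊥ := by
    by_contra hne
    obtain ⟨g, hg, hgx⟩ := hx
    exact hgx (commutator_le_of_normal hne hg x hxJ)
  intro g hg
  have : g ∈ N := hg
  rwa [hbot, Subgroup.mem_bot] at this

theorem exists_fixed_of_commute {ρ : F →* diffPlus}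
    (hρ : ∀ J, IsComponent J (supp ρ ⊤) → ¬ FaithfulOn ρ J ∨ SemiconjStandardOn ρ J)
    {x : unitInterval} (hx : x ∈ supp ρ ⁅(⊤ : Subgroup F), (⊤ : Subgroup F)⁆) :
    ∃ u v m, u < x ∧ x < v ∧ u < m ∧ m < v ∧
      (∀ y, u < y → y < v → ∃ g, (ρ g : HomeoPlus) y ≠ y) ∧
      ∀ k : HomeoPlus, (∀ g, Commute k (ρ g : HomeoPlus)) → k u = u ∧ k v = v ∧ k m = m := by
  have hxT : x ∈ supp ρ ⊤ := by
    obtain ⟨g, -, hg⟩ := hx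
    exact ⟨g, trivial, hg⟩
  obtain ⟨u, v, hux, hxv, hu, hv, hsub, hJ⟩ := connectedComponentIn_eq_Ioo (isOpen_supp ρ ⊤)
    (zero_notMem_supp ρ ⊤) (one_notMem_supp ρ ⊤) hxT
  have hu' : ∀ g, (ρ g : HomeoPlus) u = u := fun g => (notMem_supp_iff ρ).1 hu g trivial
  have hv' : ∀ g, (ρ g : HomeoPlus) v = v := fun g => (notMem_supp_iff ρ).1 hv g trivial
  have hmove : ∀ y, u < y → y < v → ∃ g, (ρ g : HomeoPlus) y ≠ y := fun y h1 h2 => by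
    obtain ⟨g, -, hg⟩ := hsub ⟨h1, h2⟩
    exact ⟨g, hg⟩
  have hfaith : FaithfulOn ρ (Set.Ioo u v) := by
    refine faithfulOn_of_commutator (fun g y hy => ⟨?_, ?_⟩) ⟨hux, hxv⟩ hx
    · rw [← hu' g, lt_iff_lt]; exact hy.1
    · rw [← hv' g, lt_iff_lt]; exact hy.2
  have hsemi := (hρ _ ⟨x, hxT, hJ.symm⟩).resolve_left (not_not.2 hfaith)
  obtain ⟨m, hum, hmv, hm⟩ := exists_fixed_of_commute_of_semiconj (hux.trans hxv) hu' hv' hmove hsemi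
  exact ⟨u, v, m, hux, hxv, hum, hmv, hmove, hm⟩

/-- Commuting actions of `F` whose nonabelian parts are semi-conjugate to the standard one have
disjoint nonabelian supports. -/
theorem disjoint_supp_of_commute {ρ₁ ρ₂ : F →* diffPlus}
    (h₁ : ∀ J, IsComponent J (supp ρ₁ ⊤) → ¬ FaithfulOn ρ₁ J ∨ SemiconjStandardOn ρ₁ J)
    (h₂ : ∀ J, IsComponent J (supp ρ₂ ⊤) → ¬ FaithfulOn ρ₂ J ∨ SemiconjStandardOn ρ₂ J)
    (hc : ∀ f g, Commute (ρ₁ f : HomeoPlus) (ρ₂ g : HomeoPlus)) :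
    Disjoint (supp ρ₁ ⁅(⊤ : Subgroup F), (⊤ : Subgroup F)⁆)
      (supp ρ₂ ⁅(⊤ : Subgroup F), (⊤ : Subgroup F)⁆) := by
  rw [Set.disjoint_left]
  intro x hx₁ hx₂
  obtain ⟨u, v, m, hux, hxv, hum, hmv, hmove, hfix⟩ := exists_fixed_of_commute h₁ hx₁
  obtain ⟨u', v', m', hux', hxv', hum', hmv', hmove', hfix'⟩ := exists_fixed_of_commute h₂ hx₂
  have key := fun g => hfix (ρ₂ g) fun f => (hc f g).symm
  have key' := fun f => hfix' (ρ₁ f) fun g => hc f g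
  have hout : ∀ y, (∀ g, (ρ₂ g : HomeoPlus) y = y) → ¬ (u' < y ∧ y < v') := fun y hy h => by
    obtain ⟨g, hg⟩ := hmove' y h.1 h.2
    exact hg (hy g)
  have hout' : ∀ y, (∀ g, (ρ₁ g : HomeoPlus) y = y) → ¬ (u < y ∧ y < v) := fun y hy h => by
    obtain ⟨g, hg⟩ := hmove y h.1 h.2
    exact hg (hy g)
  -- The endpoints `u'`, `v'` are fixed by `ρ₁`, hence lie outside `(u, v)`. Since both intervals
  -- contain `x`, `(u, v) ⊆ (u', v')`, and `m` becomes a global fixed point of `ρ₂` inside `(u',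
  -- v')`.
  refine hout m (fun g => (key g).2.2) ⟨?_, ?_⟩
  · refine lt_of_le_of_lt ?_ hum
    by_contra! h
    exact hout' u' (fun f => (key' f).1) ⟨h, hux'.trans hxv⟩
  · refine hmv.trans_le ?_
    by_contra! h
    exact hout' v' (fun f => (key' f).2.1) ⟨hux.trans hxv', h⟩

theorem disjoint_supp_commutators {ψ : F →* diffPlus}
    (hψ : ∀ ι : F →* F, Function.Injective ι → ∀ J : Set unitInterval,
      IsComponent J (supp (ψ.comp ι) ⊤) →
        ¬ FaithfulOn (ψ.comp ι) J ∨ SemiconjStandardOn (ψ.comp ι) J) :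
    Disjoint (supp ψ ⁅FMinus, FMinus⁆) (supp ψ ⁅FPlus, FPlus⁆) := by
  rw [← map_toLeft_commutator, ← map_toRight_commutator, ← supp_comp, ← supp_comp]
  refine disjoint_supp_of_commute (hψ _ toLeft_injective) (hψ _ toRight_injective) fun f g => ?_
  exact ((commute_toLeft_toRight f g).map ψ).map diffPlus.subtype


/-! ### Commuting elements of free groups -/

/-- Two distinct generators could be sent to non-commuting transpositions in `S₃`. -/
theorem subsingleton_of_freeGroup_comm {X : Type*} (h : ∀ x y : FreeGroup X, Commute x y) :
    Subsingleton X := by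
  classical
  refine ⟨fun a b => ?_⟩
  by_contra hab
  let q : FreeGroup X →* Equiv.Perm (Fin 3) :=
    FreeGroup.lift fun c => if c = a then Equiv.swap 0 1 else Equiv.swap 1 2
  have h1 := (h (FreeGroup.of a) (FreeGroup.of b)).map q
  simp only [q, FreeGroup.lift_apply_of, if_true, if_neg (Ne.symm hab)] at h1
  exact absurd h1 (by unfold Commute SemiconjBy; decide)

/-- Commuting nontrivial elements of a free group have a common nontrivial power. -/
theorem exists_zpow_eq_zpow_of_commute {X : Type*} {x y : FreeGroup X} (h : Commute x y)
    (hx : x ≠ 1) (hy : y ≠ 1) : ∃ m n : ℤ, m ≠ 0 ∧ n ≠ 0 ∧ x ^ m = y ^ n := by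
  let H : Subgroup (FreeGroup X) := Subgroup.closure {x, y}
  have hcomm : ∀ p q : H, Commute p q := by
    have := Subgroup.isMulCommutative_closure (k := {x, y}) (by
      rintro p (rfl | rfl) q (rfl | rfl)
      exacts [rfl, h.eq, h.eq.symm, rfl])
    exact fun p q => this.is_comm.comm p q
  -- By Nielsen–Schreier the subgroup `H` is free; being abelian, it has at most one free generator,
  -- so it is cyclic.
  let e := IsFreeGroup.toFreeGroup H
  have hsub : Subsingleton (IsFreeGroup.Generators H) := subsingleton_of_freeGroup_comm fun p q => by
    have := (hcomm (e.symm p) (e.symm q)).map e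
    simpa using this
  let x' : H := ⟨x, Subgroup.subset_closure (by simp)⟩
  let y' : H := ⟨y, Subgroup.subset_closure (by simp)⟩
  have hx' : x' ≠ 1 := fun h => hx (congrArg Subtype.val h)
  have hy' : y' ≠ 1 := fun h => hy (congrArg Subtype.val h)
  have hcyc : ∃ r : FreeGroup (IsFreeGroup.Generators H), ∀ p, p ∈ Subgroup.zpowers r := by
    have hne : Nonempty (IsFreeGroup.Generators H) := by
      by_contra hemp
      rw [not_nonempty_iff] at hemp
      exact hx' (e.injective (Subsingleton.elim _ _))
    obtain ⟨c⟩ := hne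
    refine ⟨FreeGroup.of c, fun p => ?_⟩
    have : p ∈ Subgroup.closure (Set.range (FreeGroup.of (α := IsFreeGroup.Generators H))) := by
      rw [FreeGroup.closure_range_of]; trivial
    rw [Subgroup.zpowers_eq_closure]
    refine Subgroup.closure_mono ?_ this
    rintro _ ⟨d, rfl⟩
    rw [Subsingleton.elim d c]
    rfl
  obtain ⟨r, hr⟩ := hcyc
  obtain ⟨i, hi⟩ := Subgroup.mem_zpowers_iff.1 (hr (e x'))
  obtain ⟨j, hj⟩ := Subgroup.mem_zpowers_iff.1 (hr (e y'))
  refine ⟨j, i, ?_, ?_, ?_⟩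
  · rintro rfl
    rw [zpow_zero] at hj
    exact hy' (e.injective (by rw [← hj, map_one]))
  · rintro rfl
    rw [zpow_zero] at hi
    exact hx' (e.injective (by rw [← hi, map_one]))
  · have : x' ^ j = y' ^ i := e.injective (by
      rw [map_zpow, map_zpow, ← hi, ← hj, ← zpow_mul, ← zpow_mul, mul_comm])
    exact congrArg Subtype.val this

/-! ### The free product of a group with `ℤ` -/

section Coprod

open Monoid (Coprod)

variable (G : Type*) [Group G]

/-- Left translation on the free group on the elements of `G`. -/
def translation : G →* MulAut (FreeGroup G) where
  toFun g := FreeGroup.freeGroupCongr (Equiv.mulLeft g)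
  map_one' := by
    ext x
    change FreeGroup.map _ x = x
    convert FreeGroup.map.id x using 2
    ext; simp
  map_mul' g h := by
    ext x
    change FreeGroup.map _ x = FreeGroup.map _ (FreeGroup.map _ x)
    rw [FreeGroup.map.comp]
    congr 2
    ext; simp

variable {G}

theorem translation_of (g h : G) : translation G g (FreeGroup.of h) = FreeGroup.of (g * h) :=
  FreeGroup.map.of

/-- The generator of the factor `ℤ` of `G * ℤ`. -/
def stable (G : Type*) [Group G] : Coprod G (Multiplicative ℤ) :=
  Coprod.inr (Multiplicative.ofAdd 1)

variable (G) in
/-- The map from `G * ℤ` to the semidirect product of the free group on `G` with `G`. -/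
def toSemidirect : Coprod G (Multiplicative ℤ) →* FreeGroup G ⋊[translation G] G :=
  Coprod.lift SemidirectProduct.inr
    (zpowersHom _ (SemidirectProduct.inl (FreeGroup.of 1)))

variable (G) in
/-- The inverse of `toSemidirect`. -/
def ofSemidirect : FreeGroup G ⋊[translation G] G →* Coprod G (Multiplicative ℤ) :=
  SemidirectProduct.lift
    (FreeGroup.lift fun g => Coprod.inl g * stable G * (Coprod.inl g)⁻¹) Coprod.inl (by
      intro g
      ext h
      simp [translation_of, MulAut.conj_apply, mul_assoc])

theorem toSemidirect_injective : Function.Injective (toSemidirect G) := by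
  have h : (ofSemidirect G).comp (toSemidirect G) = MonoidHom.id _ := by
    refine Coprod.hom_ext ?_ ?_
    · ext g
      simp [toSemidirect, ofSemidirect]
    · ext
      simp [toSemidirect, ofSemidirect, stable]
  exact Function.LeftInverse.injective (g := ofSemidirect G) fun x => DFunLike.congr_fun h x

theorem toSemidirect_right (w : Coprod G (Multiplicative ℤ)) :
    (toSemidirect G w).right = Coprod.fst w := by
  have h : SemidirectProduct.rightHom.comp (toSemidirect G) = Coprod.fst := by
    refine Coprod.hom_ext ?_ ?_
    · ext g
      simp [toSemidirect]
    · ext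
      simp [toSemidirect]
  exact DFunLike.congr_fun h w

theorem exists_toSemidirect_eq_inl {w : Coprod G (Multiplicative ℤ)} (hw : Coprod.fst w = 1) :
    ∃ x, toSemidirect G w = SemidirectProduct.inl x :=
  ⟨(toSemidirect G w).left, SemidirectProduct.ext rfl (by rw [toSemidirect_right, hw]; rfl)⟩

/-- The kernel of the projection to `G` embeds in the free group factor of the semidirect product,
where the statement is known. -/
theorem exists_zpow_eq_zpow_of_commute_coprod {v w : Coprod G (Multiplicative ℤ)}
    (hv : Coprod.fst v = 1) (hw : Coprod.fst w = 1) (h : Commute v w) (hv1 : v ≠ 1) (hw1 : w ≠ 1) :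
    ∃ m n : ℤ, m ≠ 0 ∧ n ≠ 0 ∧ v ^ m = w ^ n := by
  obtain ⟨x, hx⟩ := exists_toSemidirect_eq_inl hv
  obtain ⟨y, hy⟩ := exists_toSemidirect_eq_inl hw
  have hxy : Commute x y := by
    have := h.map (toSemidirect G)
    rw [hx, hy] at this
    refine SemidirectProduct.inl_injective (φ := translation G) ?_
    rw [map_mul, map_mul, this.eq]
  obtain ⟨m, n, hm, hn, hmn⟩ := exists_zpow_eq_zpow_of_commute hxy
    (fun h1 => hv1 (toSemidirect_injective (by rw [hx, h1, map_one, map_one])))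
    (fun h1 => hw1 (toSemidirect_injective (by rw [hy, h1, map_one, map_one])))
  refine ⟨m, n, hm, hn, toSemidirect_injective ?_⟩
  rw [map_zpow, map_zpow, hx, hy, ← map_zpow, ← map_zpow, hmn]

/-! ### A permutation action detecting nontrivial words in `G * ℤ`. -/

open Classical in
/-- The action of `G * ℤ` on `G × ℤ` in which `G` translates the first factor, and the generator
of `ℤ` shifts the fibre over `1`. -/
noncomputable def fibreAction (G : Type*) [Group G] :
    Coprod G (Multiplicative ℤ) →* Equiv.Perm (G × ℤ) :=
  Coprod.lift
    { toFun := fun g => (Equiv.mulLeft g).prodCongr (Equiv.refl ℤ)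
      map_one' := by ext <;> simp
      map_mul' := fun g h => by ext <;> simp [mul_assoc] }
    (zpowersHom _ (Equiv.prodShear (Equiv.refl G) fun g => Equiv.addRight (if g = 1 then 1 else 0)))

theorem fibreAction_inl (g x : G) (n : ℤ) :
    fibreAction G (Coprod.inl g) (x, n) = (g * x, n) := rfl

open Classical in
theorem fibreAction_stable (x : G) (n : ℤ) :
    fibreAction G (stable G) (x, n) = (x, n + if x = 1 then 1 else 0) := by
  simp [fibreAction, stable, Equiv.prodShear]

open Classical in
theorem fibreAction_stable_inv (x : G) (n : ℤ) :
    (fibreAction G (stable G))⁻¹ (x, n) = (x, n - if x = 1 then 1 else 0) := by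
  rw [Equiv.Perm.inv_eq_iff_eq, fibreAction_stable, sub_add_cancel]

/-- The commutator word whose image acts trivially near global fixed points. -/
def commWord {H : Type*} [Group H] (a b t : H) : H :=
  ⁅⁅t * a * t⁻¹, b * (t * b * t⁻¹) * b⁻¹⁆, a⁆

theorem map_commWord {H K : Type*} [Group H] [Group K] (q : H →* K) (a b t : H) :
    q (commWord a b t) = commWord (q a) (q b) (q t) := by
  simp [commWord, commutatorElement_def]

theorem commWord_ne_one {a b : G} (hab : Commute a b)
    (hind : ∀ i j : ℤ, a ^ i * b ^ j = 1 → i = 0 ∧ j = 0) :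
    commWord (Coprod.inl a) (Coprod.inl b) (stable G) ≠ 1 := by
  intro h
  let pos : ℤ → ℤ → G := fun i j => a ^ i * b ^ j
  have hpos : ∀ i j, pos i j = 1 ↔ i = 0 ∧ j = 0 := fun i j =>
    ⟨hind i j, by rintro ⟨rfl, rfl⟩; simp [pos]⟩
  have ha : ∀ i j n, fibreAction G (Coprod.inl a) (pos i j, n) = (pos (i + 1) j, n) := by
    intro i j n
    rw [fibreAction_inl]
    simp only [pos]
    rw [← mul_assoc, ← zpow_one_add, add_comm]
  have ha' : ∀ i j n, (fibreAction G (Coprod.inl a))⁻¹ (pos i j, n) = (pos (i - 1) j, n) := by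
    intro i j n
    rw [Equiv.Perm.inv_eq_iff_eq, ha, sub_add_cancel]
  have hb : ∀ i j n, fibreAction G (Coprod.inl b) (pos i j, n) = (pos i (j + 1), n) := by
    intro i j n
    rw [fibreAction_inl]
    simp only [pos]
    rw [← mul_assoc, ← (hab.zpow_left i).eq, mul_assoc, ← zpow_one_add, add_comm]
  have hb' : ∀ i j n, (fibreAction G (Coprod.inl b))⁻¹ (pos i j, n) = (pos i (j - 1), n) := by
    intro i j n
    rw [Equiv.Perm.inv_eq_iff_eq, hb, sub_add_cancel]
  -- Following the point `(1, 0)` through the word from right to left, the first coordinate equals 1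
  -- at just one occurrence of `t` or its inverse, the leftmost letter `t`. The word therefore sends
  -- `(1, 0)` to `(1, 1)`.
  have h1 := congrArg (fun p => fibreAction G p (pos 0 0, 0)) h
  simp only [map_commWord, map_one, Equiv.Perm.one_apply] at h1
  simp only [commWord, commutatorElement_def, mul_inv_rev, inv_inv, Equiv.Perm.mul_apply, ha, ha',
    hb, hb', fibreAction_stable, fibreAction_stable_inv, hpos] at h1
  norm_num at h1

end Coprod


/-! ### Groups of homeomorphisms and elements trivial near the global fixed points -/

theorem eventually_fixed_mul {f g : HomeoPlus} {z : unitInterval} (hf : ∀ᶠ y in 𝓝 z, f y = y)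
    (hg : ∀ᶠ y in 𝓝 z, g y = y) : ∀ᶠ y in 𝓝 z, (f * g) y = y := by
  filter_upwards [hf, hg] with y h1 h2
  rw [mul_apply, h2, h1]

theorem eventually_fixed_inv {f : HomeoPlus} {z : unitInterval} (hf : ∀ᶠ y in 𝓝 z, f y = y) :
    ∀ᶠ y in 𝓝 z, f⁻¹ y = y := by
  filter_upwards [hf] with y h1
  rwa [inv_apply_eq_self_iff]

theorem tendsto_of_fixed {f : HomeoPlus} {z : unitInterval} (h : f z = z) :
    Tendsto f (𝓝 z) (𝓝 z) := by
  have := (continuous_coe f).tendsto z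
  rwa [h] at this

theorem exists_bounds_of_eventually_fixed {f : HomeoPlus} {u v : unitInterval} (huv : u < v)
    (hu : ∀ᶠ y in 𝓝 u, f y = y) (hv : ∀ᶠ y in 𝓝 v, f y = y) :
    ∃ k m, u < k ∧ m < v ∧ ∀ y, f y ≠ y → u < y → y < v → k ≤ y ∧ y ≤ m := by
  obtain ⟨k, hk, hk'⟩ := exists_Ico_subset_of_mem_nhds hu ⟨v, huv⟩
  obtain ⟨m, hm, hm'⟩ := exists_Ioc_subset_of_mem_nhds hv ⟨u, huv⟩
  refine ⟨k, m, hk, hm, fun y hy h1 h2 => ⟨?_, ?_⟩⟩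
  · by_contra! h
    exact hy (hk' ⟨h1.le, h⟩)
  · by_contra! h
    exact hy (hm' ⟨h, h2.le⟩)

section Faithful

variable {Γ : Type*} [Group Γ] {Ψ : Γ →* HomeoPlus} {N : Subgroup Γ}

theorem apply_ne_iff_of_zpow_eq {v w : Γ} {m n : ℤ} (hm : m ≠ 0) (hn : n ≠ 0)
    (h : v ^ m = w ^ n) (y : unitInterval) : Ψ v y = y ↔ Ψ w y = y := by
  rw [← zpow_apply_eq_self_iff (Ψ v) hm, ← zpow_apply_eq_self_iff (Ψ w) hn, ← map_zpow, ← map_zpow,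
    h]

/-- In a faithful action on the interval, an element of a normal subgroup with cyclic centralizers
cannot be trivial near all global fixed points, unless it is trivial. -/
theorem eq_one_of_eventually_fixed_of_cover [N.Normal] (hinj : Function.Injective Ψ)
    (hN : ∀ v ∈ N, ∀ w ∈ N, Commute v w → v ≠ 1 → w ≠ 1 →
      ∃ m n : ℤ, m ≠ 0 ∧ n ≠ 0 ∧ v ^ m = w ^ n)
    (T : Finset (unitInterval × unitInterval))
    (hT : ∀ p ∈ T, (∀ g, Ψ g p.1 = p.1) ∧ (∀ g, Ψ g p.2 = p.2) ∧
      ∀ y, p.1 < y → y < p.2 → ∃ g, Ψ g y ≠ y)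
    {w : Γ} (hw : w ∈ N) (hev : ∀ z, (∀ g, Ψ g z = z) → ∀ᶠ y in 𝓝 z, Ψ w y = y)
    (hcov : ∀ y, Ψ w y ≠ y → ∃ p ∈ T, p.1 < y ∧ y < p.2) : w = 1 := by
  classical
  induction T using Finset.induction_on generalizing w with
  | empty =>
    refine hinj (DFunLike.ext _ _ fun y => ?_)
    rw [map_one, one_apply]
    by_contra hy
    obtain ⟨p, hp, -⟩ := hcov y hy
    simp at hp
  | insert p T hpT ih =>
    have hT' := fun q hq => hT q (Finset.mem_insert_of_mem hq)
    obtain ⟨hu, hv, hmove⟩ := hT p (Finset.mem_insert_self _ _)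
    by_cases htriv : ∀ y, p.1 < y → y < p.2 → Ψ w y = y
    · refine ih hT' hw hev fun y hy => ?_
      obtain ⟨q, hq, hqy⟩ := hcov y hy
      rcases Finset.mem_insert.1 hq with rfl | hq
      · exact absurd (htriv y hqy.1 hqy.2) hy
      · exact ⟨q, hq, hqy⟩
    push Not at htriv
    obtain ⟨x, hux, hxv, hx⟩ := htriv
    obtain ⟨k, m, huk, hmv, hkm⟩ := exists_bounds_of_eventually_fixed (hux.trans hxv)
      (hev _ hu) (hev _ hv)
    -- Within the interval `p`, the support of `w` lies in `[k, m]`. There are no global fixed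
    -- points there, so some `g` carries `k` beyond `m` and conjugation by `g` displaces this
    -- support from itself.
    obtain ⟨g, hg⟩ := exists_lt_apply_of_forall Ψ (x := k) (y := m) fun z h1 h2 =>
      hmove z (huk.trans_le h1) (h2.trans_lt hmv)
    by_contra hw1
    set w₁ := g * w * g⁻¹ with hw₁
    have hw₁N : w₁ ∈ N := ‹N.Normal›.conj_mem w hw g
    have hw₁1 : w₁ ≠ 1 := by
      rw [hw₁, Ne, conj_eq_one_iff]; exact hw1
    have happ : ∀ y, Ψ w₁ y = Ψ g (Ψ w ((Ψ g)⁻¹ y)) := by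
      intro y
      rw [hw₁, map_mul, map_mul, map_inv]
      rfl
    have hmoved : ∀ y, Ψ w₁ y ≠ y → Ψ w ((Ψ g)⁻¹ y) ≠ (Ψ g)⁻¹ y := by
      intro y hy h
      rw [happ, h, apply_inv_apply] at hy
      exact hy rfl
    have hinv : ∀ z, (∀ g, Ψ g z = z) → (Ψ g)⁻¹ z = z := fun z hz =>
      (inv_apply_eq_self_iff _).2 (hz g)
    have hbetween : ∀ q ∈ insert p T, ∀ y,
        q.1 < (Ψ g)⁻¹ y ∧ (Ψ g)⁻¹ y < q.2 → q.1 < y ∧ y < q.2 := by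
      intro q hq y hy
      obtain ⟨h1, h2, -⟩ := hT q hq
      rw [lt_inv_iff, inv_lt_iff, h1, h2] at hy
      exact hy
    have hbetween' : ∀ y, p.1 < y ∧ y < p.2 → p.1 < (Ψ g)⁻¹ y ∧ (Ψ g)⁻¹ y < p.2 := by
      intro y hy
      rwa [lt_inv_iff, inv_lt_iff, hu, hv]
    have hdisj : ∀ y, p.1 < y → y < p.2 → Ψ w y = y ∨ Ψ w₁ y = y := by
      intro y h1 h2
      by_contra! hc
      have h3 := (hkm y hc.1 h1 h2).2
      obtain ⟨h4, h5⟩ := hbetween' y ⟨h1, h2⟩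
      have h6 := (hkm _ (hmoved y hc.2) h4 h5).1
      rw [le_inv_iff] at h6
      exact absurd (hg.trans_le h6) (not_lt.2 h3)
    -- A common nonzero power would give `w` and `w₁` the same fixed points, but `x` is moved by `w`
    -- and fixed by `w₁`.
    have hcomm : ¬ Commute w w₁ := by
      intro hc
      obtain ⟨i, j, hi, hj, hij⟩ := hN w hw w₁ hw₁N hc hw1 hw₁1
      have h1 := (apply_ne_iff_of_zpow_eq (Ψ := Ψ) hi hj hij x).not.1 hx
      rcases hdisj x hux hxv with h | h
      · exact hx h
      · exact h1 h
    -- The elements `w` and `w₁` commute on the interval `p`, so their commutator is supported in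
    -- the intervals of `T` alone and is trivial by induction.
    refine hcomm (commutatorElement_eq_one_iff_commute.1 (ih hT' (w := ⁅w, w₁⁆) ?_ ?_ ?_))
    · exact N.mul_mem (N.mul_mem (N.mul_mem hw hw₁N) (N.inv_mem hw)) (N.inv_mem hw₁N)
    · intro z hz
      have h1 := hev z hz
      have h2 : ∀ᶠ y in 𝓝 z, Ψ w₁ y = y := by
        filter_upwards [(tendsto_of_fixed (hinv z hz)).eventually h1] with y hy
        rw [happ, hy, apply_inv_apply]
      rw [commutatorElement_def, map_mul, map_mul, map_mul, map_inv, map_inv]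
      exact eventually_fixed_mul (eventually_fixed_mul (eventually_fixed_mul h1 h2)
        (eventually_fixed_inv h1)) (eventually_fixed_inv h2)
    · intro y hy
      have hpq : ∃ q ∈ insert p T, q.1 < y ∧ y < q.2 := by
        by_cases h1 : Ψ w y = y
        · have h2 : Ψ w₁ y ≠ y := by
            intro h2
            refine hy ?_
            rw [commutatorElement_def, map_mul, map_mul, map_mul, map_inv, map_inv, mul_apply,
              (inv_apply_eq_self_iff _).2 h2, mul_apply, (inv_apply_eq_self_iff _).2 h1, mul_apply,
              h2, h1]
          obtain ⟨q, hq, hqy⟩ := hcov _ (hmoved y h2)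
          exact ⟨q, hq, hbetween q hq y hqy⟩
        · exact hcov y h1
      obtain ⟨q, hq, hqy⟩ := hpq
      rcases Finset.mem_insert.1 hq with rfl | hq
      · exfalso
        have hstab : ∀ (f : Γ) (y : unitInterval), q.1 < y ∧ y < q.2 →
            q.1 < Ψ f y ∧ Ψ f y < q.2 := by
          intro f y hy
          rwa [← lt_iff_lt (Ψ f), hu, ← lt_iff_lt (Ψ f) (x := y), hv] at hy
        set z := Ψ (w₁ * w)⁻¹ y with hz
        have hzq := hstab (w₁ * w)⁻¹ y hqy
        have hcm : Ψ w (Ψ w₁ z) = Ψ w₁ (Ψ w z) := apply_comm_of_fixed (hdisj z hzq.1 hzq.2)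
          (hdisj _ (hstab w z hzq).1 (hstab w z hzq).2)
          (hdisj _ (hstab w₁ z hzq).1 (hstab w₁ z hzq).2)
        refine hy ?_
        have h1 : Ψ ⁅w, w₁⁆ y = Ψ w (Ψ w₁ z) := by
          rw [hz, ← mul_apply, ← mul_apply, ← map_mul, ← map_mul, commutatorElement_def]
          congr 2
          group
        rw [h1, hcm, hz, ← mul_apply, ← mul_apply, ← map_mul, ← map_mul]
        simp [one_apply]
      · exact ⟨q, hq, hqy⟩

/-- By compactness the support of `w` meets only finitely many components of the complement of the
global fixed set: near a global fixed point `w` is trivial, so no component is needed there. -/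
theorem eq_one_of_eventually_fixed [N.Normal] (hinj : Function.Injective Ψ)
    (hN : ∀ v ∈ N, ∀ w ∈ N, Commute v w → v ≠ 1 → w ≠ 1 →
      ∃ m n : ℤ, m ≠ 0 ∧ n ≠ 0 ∧ v ^ m = w ^ n)
    {w : Γ} (hw : w ∈ N) (hev : ∀ z, (∀ g, Ψ g z = z) → ∀ᶠ y in 𝓝 z, Ψ w y = y) : w = 1 := by
  classical
  let Z : Set unitInterval := {z | ∀ g, Ψ g z = z}
  have hZ : IsClosed Z := by
    have : Z = ⋂ g, {z | Ψ g z = z} := by ext; simp [Z]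
    rw [this]
    exact isClosed_iInter fun g => isClosed_eq (continuous_coe _) continuous_id
  have hcover : ∃ T : Finset (unitInterval × unitInterval),
      (∀ p ∈ T, p.1 ∈ Z ∧ p.2 ∈ Z ∧ ∀ y, p.1 < y → y < p.2 → y ∉ Z) ∧
      ∀ y ∈ (Set.univ : Set unitInterval), Ψ w y ≠ y → ∃ p ∈ T, p.1 < y ∧ y < p.2 := by
    refine isCompact_univ.induction_on (p := fun s => ∃ T : Finset (unitInterval × unitInterval),
      (∀ p ∈ T, p.1 ∈ Z ∧ p.2 ∈ Z ∧ ∀ y, p.1 < y → y < p.2 → y ∉ Z) ∧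
      ∀ y ∈ s, Ψ w y ≠ y → ∃ p ∈ T, p.1 < y ∧ y < p.2) ?_ ?_ ?_ ?_
    · exact ⟨∅, by simp, by simp⟩
    · rintro s t hst ⟨T, h1, h2⟩
      exact ⟨T, h1, fun y hy => h2 y (hst hy)⟩
    · rintro s t ⟨T, h1, h2⟩ ⟨T', h1', h2'⟩
      refine ⟨T ∪ T', fun p hp => (Finset.mem_union.1 hp).elim (h1 p) (h1' p), fun y hy hne => ?_⟩
      rcases hy with hy | hy
      · obtain ⟨p, hp, h⟩ := h2 y hy hne
        exact ⟨p, Finset.mem_union_left _ hp, h⟩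
      · obtain ⟨p, hp, h⟩ := h2' y hy hne
        exact ⟨p, Finset.mem_union_right _ hp, h⟩
    · intro x _
      by_cases hx : x ∈ Z
      · exact ⟨_, mem_nhdsWithin_of_mem_nhds (hev x hx), ∅, by simp, fun y hy h => absurd hy h⟩
      · obtain ⟨u, v, hux, hxv, hu, hv, hsub, -⟩ := connectedComponentIn_eq_Ioo hZ.isOpen_compl
          (not_not.2 fun g => apply_zero _) (not_not.2 fun g => apply_one _) hx
        refine ⟨_, mem_nhdsWithin_of_mem_nhds (Ioo_mem_nhds hux hxv), {(u, v)}, ?_, ?_⟩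
        · intro p hp
          rw [Finset.mem_singleton.1 hp]
          exact ⟨not_not.1 hu, not_not.1 hv, fun y h1 h2 => hsub ⟨h1, h2⟩⟩
        · intro y hy _
          exact ⟨_, Finset.mem_singleton_self _, hy⟩
  obtain ⟨T, hT, hcov⟩ := hcover
  refine eq_one_of_eventually_fixed_of_cover hinj hN T (fun p hp => ?_) hw hev
    fun y hy => hcov y trivial hy
  obtain ⟨h1, h2, h3⟩ := hT p hp
  refine ⟨h1, h2, fun y hy hy' => ?_⟩
  by_contra! hc
  exact h3 y hy hy' hc

end Faithful

/-! ### Disjoint supports and a commutator word -/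

/-- `f` and `g` move `y` to fixed points of each other. -/
def JumpsAcross (f g : HomeoPlus) (y : unitInterval) : Prop :=
  f y ≠ y ∧ g y ≠ y ∧ g (f y) = f y ∧ f (g y) = g y

theorem JumpsAcross.opposite {f g : HomeoPlus} {y : unitInterval} (h : JumpsAcross f g y) :
    (f y < y ∧ y < g y ∧ g (f y) = f y ∧ f (g y) = g y) ∨
      (g y < y ∧ y < f y ∧ f (g y) = g y ∧ g (f y) = f y) := by
  obtain ⟨hf, hg, h1, h2⟩ := h
  rcases lt_or_gt_of_ne hf with hf | hf <;> rcases lt_or_gt_of_ne hg with hg | hg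
  · have e1 := (lt_iff_lt g).2 hf
    have e2 := (lt_iff_lt f).2 hg
    rw [h1] at e1
    rw [h2] at e2
    exact absurd e1 (lt_asymm e2)
  · exact Or.inl ⟨hf, hg, h1, h2⟩
  · exact Or.inr ⟨hg, hf, h2, h1⟩
  · have e1 := (lt_iff_lt g).2 hf
    have e2 := (lt_iff_lt f).2 hg
    rw [h1] at e1
    rw [h2] at e2
    exact absurd e1 (lt_asymm e2)

theorem IsC1.eventually_not_jumpsAcross {f g : HomeoPlus} (hf : IsC1 f) (hg : IsC1 g)
    {x : unitInterval} (hfx : f x = x) (hgx : g x = x) : ∀ᶠ y in 𝓝 x, ¬ JumpsAcross f g y := by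
  filter_upwards [hf.eventually_not_opposite_jumps hg hfx hgx,
    hg.eventually_not_opposite_jumps hf hgx hfx] with y h1 h2 h
  exact h.opposite.elim h1 h2

/-- As `A` moves `z`, `B` fixes it. At most one of `C`, `D` moves `z`, and without a jump each
intermediate point is fixed by the relevant letter, so the word collapses at `z`. -/
theorem jumpsAcross_of_commutator_apply_ne {A B C D : HomeoPlus} (hAB : ∀ x, A x = x ∨ B x = x)
    (hCD : ∀ x, C x = x ∨ D x = x) {z : unitInterval} (hA : A z ≠ z)
    (hz : ⁅C, B * D * B⁻¹⁆ z ≠ z) :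
    JumpsAcross C B⁻¹ (C⁻¹ z) ∨ JumpsAcross D B (D⁻¹ z) := by
  have hBz : B z = z := (hAB z).resolve_left hA
  have hBz' : B⁻¹ z = z := (inv_apply_eq_self_iff B).2 hBz
  by_contra! hc
  obtain ⟨hc₁, hc₂⟩ := hc
  have happ : ⁅C, B * D * B⁻¹⁆ z = C (B (D (B⁻¹ (C⁻¹ (B (D⁻¹ (B⁻¹ z))))))) := by
    rw [commutatorElement_def, mul_inv_rev, mul_inv_rev, inv_inv]
    rfl
  refine hz ?_
  rw [happ, hBz']
  by_cases hD : D z = z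
  · rw [(inv_apply_eq_self_iff D).2 hD, hBz]
    set y := C⁻¹ z with hy
    have hCy : C y = z := apply_inv_apply C z
    by_cases hyz : z = y
    · rw [← hyz, hBz', hD, hBz]
      rw [hyz, hCy]; exact hyz
    have hDy : D y = y := (hCD y).resolve_left (by rw [hCy]; exact hyz)
    by_cases hBy : B⁻¹ y = y
    · rw [hBy, hDy, (inv_apply_eq_self_iff B).1 hBy, hCy]
    have hDy' : D (B⁻¹ y) = B⁻¹ y := by
      refine (hCD _).resolve_left fun h => hc₁ ⟨?_, hBy, ?_, h⟩
      · rw [hCy]; exact hyz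
      · rw [hCy, hBz']
    rw [hDy', apply_inv_apply, hCy]
  · set y := D⁻¹ z with hy
    have hDy : D y = z := apply_inv_apply D z
    have hCz : C z = z := (hCD z).resolve_right hD
    have hyz : z ≠ y := fun h => hD (by rwa [← h] at hDy)
    have hCy : C y = y := (hCD y).resolve_right (by rw [hDy]; exact hyz)
    have hBD : C (B y) = B y := by
      by_cases hBy : B y = y
      · rw [hBy, hCy]
      · refine (hCD _).resolve_right fun h => hc₂ ⟨?_, hBy, ?_, h⟩
        · rw [hDy]; exact hyz
        · rw [hDy, hBz]
    rw [(inv_apply_eq_self_iff C).2 hBD, inv_apply_apply, hDy, hBz, hCz]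

/-- If `A` and `B` have disjoint supports, the commutator word in `A`, `B`, `T` is trivial near
the common fixed points. -/
theorem eventually_commWord_fixed {A B T : diffPlus}
    (hAB : ∀ x, (A : HomeoPlus) x = x ∨ (B : HomeoPlus) x = x) {x : unitInterval}
    (hA : (A : HomeoPlus) x = x) (hB : (B : HomeoPlus) x = x) (hT : (T : HomeoPlus) x = x) :
    ∀ᶠ y in 𝓝 x, (commWord A B T : diffPlus).1 y = y := by
  set C : diffPlus := T * A * T⁻¹ with hC
  set D : diffPlus := T * B * T⁻¹ with hD
  have hT' : (T : HomeoPlus)⁻¹ x = x := (inv_apply_eq_self_iff _).2 hT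
  have hCx : (C : HomeoPlus) x = x := by
    change (T : HomeoPlus) ((A : HomeoPlus) ((T : HomeoPlus)⁻¹ x)) = x
    rw [hT', hA, hT]
  have hDx : (D : HomeoPlus) x = x := by
    change (T : HomeoPlus) ((B : HomeoPlus) ((T : HomeoPlus)⁻¹ x)) = x
    rw [hT', hB, hT]
  have hCD : ∀ y, (C : HomeoPlus) y = y ∨ (D : HomeoPlus) y = y := by
    intro y
    change (T : HomeoPlus) ((A : HomeoPlus) ((T : HomeoPlus)⁻¹ y)) = y ∨
      (T : HomeoPlus) ((B : HomeoPlus) ((T : HomeoPlus)⁻¹ y)) = y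
    refine (hAB ((T : HomeoPlus)⁻¹ y)).imp (fun h => ?_) (fun h => ?_) <;>
      rw [h, apply_inv_apply]
  have hB' : (B : HomeoPlus)⁻¹ x = x := (inv_apply_eq_self_iff _).2 hB
  have hC' : (C : HomeoPlus)⁻¹ x = x := (inv_apply_eq_self_iff _).2 hCx
  have hD' : (D : HomeoPlus)⁻¹ x = x := (inv_apply_eq_self_iff _).2 hDx
  have hA' : (A : HomeoPlus)⁻¹ x = x := (inv_apply_eq_self_iff _).2 hA
  set P : HomeoPlus := ⁅(C : HomeoPlus), (B : HomeoPlus) * D * (B : HomeoPlus)⁻¹⁆ with hP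
  have hPx : P x = x := by
    rw [hP, commutatorElement_def, mul_inv_rev, mul_inv_rev, inv_inv]
    simp only [mul_apply, hB, hB', hCx, hC', hDx, hD']
  have hP' : P⁻¹ x = x := (inv_apply_eq_self_iff _).2 hPx
  -- Near `x` jumps are excluded by differentiability, so `A` and `P` have disjoint supports there
  -- and their commutator, the word itself, is trivial.
  have key : ∀ᶠ y in 𝓝 x, (A : HomeoPlus) y ≠ y → P y = y := by
    filter_upwards [(tendsto_of_fixed hC').eventually
        (IsC1.eventually_not_jumpsAcross C.2.1 B.2.2 hCx hB'),
      (tendsto_of_fixed hD').eventually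
        (IsC1.eventually_not_jumpsAcross D.2.1 B.2.1 hDx hB)] with y h1 h2 hAy
    by_contra hPy
    exact (jumpsAcross_of_commutator_apply_ne hAB hCD hAy hPy).elim h1 h2
  have hword : ∀ y, (commWord A B T : diffPlus).1 y =
      P ((A : HomeoPlus) (P⁻¹ ((A : HomeoPlus)⁻¹ y))) := by
    intro y
    simp only [commWord, commutatorElement_def, hP, hC, hD, Subgroup.coe_mul, Subgroup.coe_inv,
      mul_apply]
  filter_upwards [key, (tendsto_of_fixed hA').eventually key,
    (tendsto_of_fixed hP').eventually key] with y h1 h2 h3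
  rw [hword]
  by_cases hAy : (A : HomeoPlus) y = y
  · rw [(inv_apply_eq_self_iff _).2 hAy]
    by_cases h4 : (A : HomeoPlus) (P⁻¹ y) = P⁻¹ y
    · rw [h4, apply_inv_apply]
    · have h5 := h3 h4
      rw [apply_inv_apply] at h5
      rw [← h5] at h4
      exact absurd hAy h4
  · have h4 : (A : HomeoPlus) ((A : HomeoPlus)⁻¹ y) ≠ (A : HomeoPlus)⁻¹ y := by
      intro h
      rw [apply_inv_apply, eq_comm, inv_apply_eq_self_iff] at h
      exact hAy h
    rw [(inv_apply_eq_self_iff P).2 (h2 h4), apply_inv_apply, h1 hAy]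

/-- The action of a free product `G * ℤ` by `C¹` diffeomorphisms is not faithful if two
independent commuting elements of `G` have disjoint supports. -/
theorem not_injective_of_disjoint_supports {G : Type*} [Group G]
    (φ : Monoid.Coprod G (Multiplicative ℤ) →* diffPlus) {a b : G} (hab : Commute a b)
    (hind : ∀ i j : ℤ, a ^ i * b ^ j = 1 → i = 0 ∧ j = 0)
    (hdisj : ∀ x, (φ (Monoid.Coprod.inl a) : HomeoPlus) x = x ∨
      (φ (Monoid.Coprod.inl b) : HomeoPlus) x = x) : ¬ Function.Injective φ := by
  intro hinj
  refine commWord_ne_one hab hind (eq_one_of_eventually_fixed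
    (Ψ := diffPlus.subtype.comp φ) (N := (Monoid.Coprod.fst (M := G)
      (N := Multiplicative ℤ)).ker) (Subtype.val_injective.comp hinj) ?_ ?_ ?_)
  · intro v hv w hw h hv1 hw1
    exact exists_zpow_eq_zpow_of_commute_coprod hv hw h hv1 hw1
  -- Killing `t` turns the word into `⁅⁅a, b * b * b⁻¹⁆, a⁆`, which is trivial because `a` and `b`
  -- commute.
  · rw [MonoidHom.mem_ker, map_commWord]
    have : Monoid.Coprod.fst (stable G) = 1 := by simp [stable]
    rw [this]
    simp only [Monoid.Coprod.fst_apply_inl, commWord, commutatorElement_def]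
    simp only [one_mul, inv_one, mul_one, mul_inv_cancel_right, hab.eq]
    simp
  · intro z hz
    have h1 := eventually_commWord_fixed (A := φ (Monoid.Coprod.inl a))
      (B := φ (Monoid.Coprod.inl b)) (T := φ (stable G)) hdisj (hz _) (hz _) (hz (stable G))
    have h2 := map_commWord φ (Monoid.Coprod.inl a) (Monoid.Coprod.inl b) (stable G)
    refine h1.mono fun y hy => ?_
    rw [MonoidHom.comp_apply, h2]
    rw [Subgroup.coe_subtype, hy]

/-- Take the copies of one nontrivial commutator in the two halves. Their supports are disjoint and
nonzero powers keep the supports, so a relation would force each exponent to vanish. -/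
theorem exists_independent : ∃ a ∈ ⁅FMinus, FMinus⁆, ∃ b ∈ ⁅FPlus, FPlus⁆, Commute a b ∧
    ∀ i j : ℤ, a ^ i * b ^ j = 1 → i = 0 ∧ j = 0 := by
  set e : F := ⁅shift, leftShift⁆ with he
  have hmem : e ∈ ⁅(⊤ : Subgroup F), (⊤ : Subgroup F)⁆ :=
    Subgroup.commutator_mem_commutator trivial trivial
  have hne : ∀ {ι : F →* F}, Function.Injective ι → ∃ x, (ι e : HomeoPlus) x ≠ x := by
    intro ι hι
    by_contra! h
    exact commutator_shift_leftShift_ne_one (hι ((F_ext (g := 1) h).trans (map_one ι).symm))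
  have hzpow : ∀ (f : F) (i : ℤ) (x : unitInterval),
      ((f ^ i : F) : HomeoPlus) x = ((f : HomeoPlus) ^ i) x := fun f i x => by
    rw [Subgroup.coe_zpow]
  have hcases : ∀ x, (toLeft e : HomeoPlus) x = x ∨ (toRight e : HomeoPlus) x = x := fun x =>
    (le_total (x : ℝ) (1 / 2)).symm.imp (toLeft_of_ge e) (toRight_of_le e)
  refine ⟨toLeft e, ?_, toRight e, ?_, commute_toLeft_toRight e e, fun i j h => ?_⟩
  · rw [← map_toLeft_commutator]; exact ⟨e, hmem, rfl⟩
  · rw [← map_toRight_commutator]; exact ⟨e, hmem, rfl⟩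
  have happ : ∀ x, ((toLeft e : HomeoPlus) ^ i) (((toRight e : HomeoPlus) ^ j) x) = x := by
    intro x
    have h1 : ((toLeft e ^ i * toRight e ^ j : F) : HomeoPlus) x = x := by rw [h]; rfl
    rwa [Subgroup.coe_mul, mul_apply, hzpow, hzpow] at h1
  constructor
  · obtain ⟨x, hx⟩ := hne toLeft_injective
    by_contra hi
    have h1 := happ x
    rw [zpow_apply_eq_self _ ((hcases x).resolve_left hx), zpow_apply_eq_self_iff _ hi] at h1
    exact hx h1
  · obtain ⟨x, hx⟩ := hne toRight_injective
    by_contra hj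
    have hfix := zpow_apply_eq_self _ ((hcases x).resolve_right hx) i
    have h1 := happ x
    exact hx ((zpow_apply_eq_self_iff _ hj).1 (((toLeft e : HomeoPlus) ^ i).injective (h1.trans hfix.symm)))

end ThompsonFree

theorem mainTheorem3 (φ : ThompsonFree.FStarZ →* ThompsonFree.diffPlus)
    (hφ : ∀ ι : ThompsonFree.F →* ThompsonFree.F, Function.Injective ι →
      ∀ J : Set unitInterval,
        ThompsonFree.IsComponent J
          (ThompsonFree.supp ((ThompsonFree.restrictF φ).comp ι) ⊤) →
        ¬ ThompsonFree.FaithfulOn ((ThompsonFree.restrictF φ).comp ι) J ∨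
          ThompsonFree.SemiconjStandardOn ((ThompsonFree.restrictF φ).comp ι) J) :
    ¬ Function.Injective φ ∧
      Disjoint
        (ThompsonFree.supp (ThompsonFree.restrictF φ)
          ⁅ThompsonFree.FMinus, ThompsonFree.FMinus⁆)
        (ThompsonFree.supp (ThompsonFree.restrictF φ)
          ⁅ThompsonFree.FPlus, ThompsonFree.FPlus⁆) := by
  have hdisj := ThompsonFree.disjoint_supp_commutators hφ
  refine ⟨?_, hdisj⟩
  obtain ⟨a, ha, b, hb, hab, hind⟩ := ThompsonFree.exists_independent
  refine ThompsonFree.not_injective_of_disjoint_supports φ hab hind fun x => ?_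
  by_contra! hc
  exact Set.disjoint_left.1 hdisj ⟨a, ha, hc.1⟩ ⟨b, hb, hc.2⟩
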